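/- Let $\mathbb K\in\{\mathbb R,\mathbb C\}$. All spaces are over $\mathbb K$; "lcHs" means locally convex Hausdorff space, $Y'$ is the space of continuous linear functionals on $Y$, and $Y_b'$ is $Y'$ with the topology of uniform convergence on bounded subsets of $Y$. An lcHs is \emph{bornological} if every absolutely convex set absorbing all bounded sets is a $0$-neighbourhood; \emph{completely normable} if its topology is induced by a complete norm; \emph{semi-reflexive} if the evaluation map $Y\to (Y_b')'$ is surjective; \emph{semi-Montel} if every bounded set is relatively compact. A \emph{Banach predual} of an lcHs $(X,\tau)$ is a pair $(Y,\varphi)$ of a completely normable lcHs $Y$ and a topological isomorphism $\varphi\colon (X,\tau)\to Y_b'$; a \emph{prebidual} is a pair $(Y,\varphi)$ of an lcHs $Y$ and a topological isomorphism $\varphi\colon(X,\tau)\to(Y_b')_b'$. For a locally convex Hausdorff topology $\widetilde\tau$ on $X$ we say that $(X,\tau)$ satisfies - (BBC) for $\widetilde\tau$ if every $\tau$-bounded set is contained in an absolutely convex $\tau$-bounded $\widetilde\tau$-compact set; - (BBCl) for $\widetilde\tau$ if every $\tau$-bounded set is contained in an absolutely convex $\tau$-bounded $\widetilde\tau$-closed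 set; - (CNC) for $\widetilde\tau$ if $\tau$ has a $0$-neighbourhood basis of absolutely convex $\widetilde\tau$-closed sets. If $(X,\tau)$ is bornological, $\widetilde\tau$ is coarser than $\tau$ (written $\widetilde\tau\le\tau$), (BBCl) holds for $\widetilde\tau$ and the family of $\tau$-bounded sets has a countable basis, then that family has a countable basis $(B_n)_{n\in\mathbb N}$ of nonempty absolutely convex $\widetilde\tau$-closed sets with $2B_n\subset B_{n+1}$ for all $n$; the \emph{mixed topology} $\gamma=\gamma(\tau,\widetilde\tau)$ is the locally convex Hausdorff topology on $X$ whose $0$-neighbourhood basis is given by the sets $\bigcup_{n}\sum_{k\le n}(U_k\cap B_k)$, where $(U_k)$ runs through the sequences of absolutely convex $\widetilde\tau$-neighbourhoods of $0$ (it does not depend on the choice of $(B_n)$). \textbf{Corollary.} Let $(X,\tau)$ be a bornological locally convex Hausdorff space. The following assertions are equivalent. (a) $(X,\tau)$ has a Banach predual. (b) $(X,\tau)$ has a semi-Montel prebidual $(Y,\varphi)$ such that $Y_b'$ is completely normable. (c) $(X,\tau)$ is completely normable, and there is a locally convex Hausdorff topology $\widetilde\tau$ on $X$ such that $(X,\tau)$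 satisfies (BBC) and (CNC) for $\widetilde\tau$ and a subset of $X$ is $\tau$-bounded if and only if it is $\gamma(\tau,\widetilde\tau)$-bounded. (d) $(X,\tau)$ is completely normable, and there is a locally convex Hausdorff topology $\widetilde\tau\le\tau$ on $X$ such that $(X,\tau)$ satisfies (BBCl) for $\widetilde\tau$ and $(X,\gamma(\tau,\widetilde\tau))$ is semi-reflexive. (e) $(X,\tau)$ is completely normable and satisfies (BBC) for some locally convex Hausdorff topology $\widetilde\tau$ on $X$. (f) There are a norm $|||\cdot|||$ on $X$ which induces $\tau$ and a locally convex Hausdorff topology $\widetilde\tau$ on $X$ such that the closed unit ball $\{x\in X : |||x|||\le 1\}$ is $\widetilde\tau$-compact. (In (c) the mixed topology is defined, since (BBC) for $\widetilde\tau$ implies (BBCl) for $\widetilde\tau$ and, as $(X,\tau)$ is bornological, $\widetilde\tau\le\tau$.) -/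

import Mathlib

open Bornology Filter Topology
open scoped Pointwise ComplexOrder

universe u

section Definitions

variable (𝕜 : Type) [RCLike 𝕜] {E : Type u} [AddCommGroup E] [Module 𝕜 E]

/-- `(E, τ)` is a locally convex Hausdorff space over `𝕜`. -/
structure IsLCHausdorff (τ : TopologicalSpace E) : Prop where
  t2 : T2Space E
  topologicalAddGroup : IsTopologicalAddGroup E
  continuousSMul : ContinuousSMul 𝕜 E
  locallyConvex : LocallyConvexSpace 𝕜 E

/-- `S` is (von Neumann) bounded in `(E, τ)`. -/
def IsBddFor (τ : TopologicalSpace E) (S : Set E) : Prop :=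
  IsVonNBounded 𝕜 S

/-- `(E, τ)` is bornological: every absolutely convex set that absorbs all bounded sets is a
neighbourhood of zero. -/
def IsBornological (τ : TopologicalSpace E) : Prop :=
  ∀ U : Set E, AbsConvex 𝕜 U → (∀ S : Set E, IsBddFor 𝕜 τ S → Absorbs 𝕜 U S) → U ∈ 𝓝 (0 : E)

/-- The (semi)norm `p` is a norm and the topology it induces on `E` is `τ`. -/
structure IsNormInducing (p : Seminorm 𝕜 E) (τ : TopologicalSpace E) : Prop where
  definite : ∀ x : E, p x = 0 → x = 0
  induces : WithSeminorms (fun _ : Fin 1 => p)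

/-- `(E, τ)` is completely normable: `τ` is induced by some complete norm on `E`. -/
def IsCompletelyNormable (τ : TopologicalSpace E) : Prop :=
  ∃ p : Seminorm 𝕜 E, IsNormInducing 𝕜 p τ ∧
    @CompleteSpace E p.toAddGroupSeminorm.toSeminormedAddCommGroup.toUniformSpace

/-- `(E, τ)` is semi-reflexive: the evaluation map from `E` to the dual of its strong dual is
surjective. (`StrongDual 𝕜 E` carries the topology of uniform convergence on bounded sets.) -/
def IsSemiReflexive (τ : TopologicalSpace E) : Prop :=
  ∀ f : StrongDual 𝕜 (StrongDual 𝕜 E), ∃ x : E, ∀ g : StrongDual 𝕜 E, f g = g x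

/-- `(E, τ)` is semi-Montel: every bounded set is relatively compact. -/
def IsSemiMontel (τ : TopologicalSpace E) : Prop :=
  ∀ S : Set E, IsBddFor 𝕜 τ S → IsCompact (closure S)

/-- `(E, τ)` has a Banach predual: a completely normable locally convex Hausdorff space `Y`
together with a topological isomorphism from `(E, τ)` onto the strong dual of `Y`. -/
def HasBanachPredual (τ : TopologicalSpace E) : Prop :=
  ∃ (Y : Type u) (_ : AddCommGroup Y) (_ : Module 𝕜 Y) (σ : TopologicalSpace Y),
    IsLCHausdorff 𝕜 σ ∧ IsCompletelyNormable 𝕜 σ ∧ Nonempty (E ≃L[𝕜] StrongDual 𝕜 Y)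

/-- `(E, τ)` has a semi-Montel prebidual with completely normable strong dual: a semi-Montel
locally convex Hausdorff space `Y` with completely normable strong dual, together with a
topological isomorphism from `(E, τ)` onto the strong dual of the strong dual of `Y`. -/
def HasSemiMontelPrebidualWithCompletelyNormableDual (τ : TopologicalSpace E) : Prop :=
  ∃ (Y : Type u) (_ : AddCommGroup Y) (_ : Module 𝕜 Y) (σ : TopologicalSpace Y),
    IsLCHausdorff 𝕜 σ ∧ IsSemiMontel 𝕜 σ ∧
      IsCompletelyNormable 𝕜 (inferInstance : TopologicalSpace (StrongDual 𝕜 Y)) ∧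
      Nonempty (E ≃L[𝕜] StrongDual 𝕜 (StrongDual 𝕜 Y))

/-- Condition (BBC) of `(E, τ)` for `τ'`: every `τ`-bounded set is contained in an absolutely
convex `τ`-bounded `τ'`-compact set. -/
def SatisfiesBBC (τ τ' : TopologicalSpace E) : Prop :=
  ∀ S : Set E, IsBddFor 𝕜 τ S →
    ∃ K : Set E, S ⊆ K ∧ AbsConvex 𝕜 K ∧ IsBddFor 𝕜 τ K ∧ @IsCompact E τ' K

/-- Condition (BBCl) of `(E, τ)` for `τ'`: every `τ`-bounded set is contained in an absolutely
convex `τ`-bounded `τ'`-closed set. -/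
def SatisfiesBBCl (τ τ' : TopologicalSpace E) : Prop :=
  ∀ S : Set E, IsBddFor 𝕜 τ S →
    ∃ K : Set E, S ⊆ K ∧ AbsConvex 𝕜 K ∧ IsBddFor 𝕜 τ K ∧ @IsClosed E τ' K

/-- Condition (CNC) of `(E, τ)` for `τ'`: `τ` has a neighbourhood basis of zero consisting of
absolutely convex `τ'`-closed sets. -/
def SatisfiesCNC (τ τ' : TopologicalSpace E) : Prop :=
  ∀ V ∈ @nhds E τ 0, ∃ U ∈ @nhds E τ 0, U ⊆ V ∧ AbsConvex 𝕜 U ∧ @IsClosed E τ' U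

/-- `B` is a countable basis of the family of `τ`-bounded sets which consists of (nonempty)
absolutely convex `τ'`-closed sets with `2 • B n ⊆ B (n + 1)`. -/
structure IsMixedBasis (τ τ' : TopologicalSpace E) (B : ℕ → Set E) : Prop where
  nonempty : ∀ n, (B n).Nonempty
  absConvex : ∀ n, AbsConvex 𝕜 (B n)
  bounded : ∀ n, IsBddFor 𝕜 τ (B n)
  closed : ∀ n, @IsClosed E τ' (B n)
  double_subset : ∀ n, (2 : 𝕜) • B n ⊆ B (n + 1)
  basis : ∀ S : Set E, IsBddFor 𝕜 τ S → ∃ n, S ⊆ B n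

/-- The set `⋃ₙ ∑_{k ≤ n} (U k ∩ B k)`, with Minkowski sums. -/
def mixedSet (U B : ℕ → Set E) : Set E :=
  ⋃ n : ℕ, ∑ k ∈ Finset.range (n + 1), (U k ∩ B k)

/-- `U` is a sequence of absolutely convex neighbourhoods of zero for `τ'`. -/
def IsDiskNhdSeq (τ' : TopologicalSpace E) (U : ℕ → Set E) : Prop :=
  ∀ n, AbsConvex 𝕜 (U n) ∧ U n ∈ @nhds E τ' 0

theorem mixedSet_mono {F : Type u} [AddCommGroup F] {U V B : ℕ → Set F} (h : ∀ n, U n ⊆ V n) : mixedSet U B ⊆ mixedSet V B := by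
  refine Set.iUnion_mono fun n => ?_
  exact Set.finsetSum_subset_finsetSum _ _ _ fun k _ => Set.inter_subset_inter_left _ (h k)

/-- The mixed topology `γ(τ, τ')`: the translation invariant topology whose neighbourhoods of zero
are generated by the sets `⋃ₙ ∑_{k ≤ n} (U k ∩ B k)`, where `U` runs through the sequences of
absolutely convex `τ'`-neighbourhoods of zero and `B` is a basis of the `τ`-bounded sets as in
`IsMixedBasis`. The neighbourhoods do not depend on the choice of `B`, and `B` exists when `τ'` is
coarser than `τ`, the `τ`-bounded sets have a countable basis and (BBCl) holds for `τ'`; the mixed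
topology is used in this case only. -/
def mixedTopology (τ τ' : TopologicalSpace E) : TopologicalSpace E where
  IsOpen O := ∀ x ∈ O, ∀ B : ℕ → Set E, IsMixedBasis 𝕜 τ τ' B →
    ∃ U : ℕ → Set E, IsDiskNhdSeq 𝕜 τ' U ∧ ∀ y ∈ mixedSet U B, x + y ∈ O
  isOpen_univ := fun _ _ _ _ =>
    ⟨fun _ => Set.univ, fun _ => ⟨AbsConvex.univ, @Filter.univ_mem _ (@nhds E τ' 0)⟩,
      fun _ _ => Set.mem_univ _⟩
  isOpen_inter := by
    intro O₁ O₂ h₁ h₂ x hx B hB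
    obtain ⟨U₁, hU₁, hO₁⟩ := h₁ x hx.1 B hB
    obtain ⟨U₂, hU₂, hO₂⟩ := h₂ x hx.2 B hB
    exact ⟨fun n => U₁ n ∩ U₂ n,
      fun n => ⟨(hU₁ n).1.inter (hU₂ n).1, Filter.inter_mem (hU₁ n).2 (hU₂ n).2⟩,
      fun y hy => ⟨hO₁ y (mixedSet_mono (fun _ => Set.inter_subset_left) hy),
        hO₂ y (mixedSet_mono (fun _ => Set.inter_subset_right) hy)⟩⟩
  isOpen_sUnion := by
    intro s hs x hx B hB
    obtain ⟨O, hO, hxO⟩ := hx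
    obtain ⟨U, hU, hUO⟩ := hs O hO x hxO B hB
    exact ⟨U, hU, fun y hy => ⟨O, hO, hUO y hy⟩⟩

/-- Condition (BτBγ): the `τ`-bounded sets are exactly the `γ`-bounded sets. -/
def SameBoundedSets (τ γ : TopologicalSpace E) : Prop :=
  ∀ S : Set E, IsBddFor 𝕜 τ S ↔ IsBddFor 𝕜 γ S

end Definitions

/-! Everything passes through (f). From (a), Alaoglu's theorem makes the dual unit ball weak*
compact, which is (f). Conversely (Dixmier–Ng), the functionals that are `τ'`-continuous on the
compact unit ball form a norm-closed, hence complete, subspace of the dual. It is norming by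
Hahn–Banach, as the ball is `τ'`-closed, and every continuous functional on it is an evaluation.
This last fact rests on the main tool, `exists_eq_eval_of_bound_on_compact`: separation in finite
dimensions meets finitely many conditions at a time, and compactness meets all of them at once.

The same tool shows that a Banach space `Z` is the strong dual of `Z'` with compact convergence.
That space is semi-Montel by Banach–Steinhaus, Alaoglu and Ascoli, so (a) gives (b). For the
converse, the strong dual of the semi-Montel space is itself a Banach predual.

Under (f), a set bounded for the mixed topology `γ` but not for the norm would be detected by a
sequence of ever smaller `τ'`-continuous functionals; this gives (c). Moreover, `γ`-continuous
functionals are `τ'`-continuous on the ball, so the main tool gives the semi-reflexivity in (d).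
Conversely, under (d) the sets from (BBCl) equal their bipolars and are therefore compact for the
weak topology of the `γ`-dual, which is (e). Finally, (e) yields (f): the gauge of a compact disk
containing a unit ball is an equivalent norm. -/

section Separation

/-! ### Hahn–Banach separation and functionals dominated on a compact disk -/

variable {𝕜 : Type*} [RCLike 𝕜] {E : Type*} [AddCommGroup E] [Module 𝕜 E]

theorem locallyConvexSpace_rclike_iff_real [TopologicalSpace E] [Module ℝ E]
    [IsScalarTower ℝ 𝕜 E] : LocallyConvexSpace 𝕜 E ↔ LocallyConvexSpace ℝ E := by
  simp only [locallyConvexSpace_iff, convex_RCLike_iff_convex_real (K := 𝕜)]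

theorem RCLike.locallyConvexSpace_self : LocallyConvexSpace 𝕜 𝕜 :=
  locallyConvexSpace_rclike_iff_real.2 inferInstance

theorem AbsConvex.zero_mem {C : Set E} (hC : AbsConvex 𝕜 C) (hne : C.Nonempty) : (0 : E) ∈ C :=
  hC.1.zero_mem hne

/-- A point outside a nonempty closed absolutely convex set is separated from it by the polar. -/
theorem AbsConvex.exists_strongDual_separating [TopologicalSpace E] [IsTopologicalAddGroup E]
    [ContinuousSMul 𝕜 E] [LocallyConvexSpace 𝕜 E] {C : Set E} (hC : AbsConvex 𝕜 C)
    (hcl : IsClosed C) (hne : C.Nonempty) {x : E} (hx : x ∉ C) :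
    ∃ g : StrongDual 𝕜 E, (∀ y ∈ C, ‖g y‖ ≤ 1) ∧ 1 < ‖g x‖ := by
  let : Module ℝ E := Module.restrictScalars ℝ 𝕜 E
  have : IsScalarTower ℝ 𝕜 E := IsScalarTower.restrictScalars ℝ 𝕜 E
  have : LocallyConvexSpace ℝ E :=
    (locallyConvexSpace_rclike_iff_real (𝕜 := 𝕜)).1 inferInstance
  obtain ⟨f, u, hf, hu⟩ := RCLike.geometric_hahn_banach_closed_point (𝕜 := 𝕜)
    (convex_RCLike_iff_convex_real.1 hC.2) hcl hx
  have hu0 : 0 < u := by simpa using hf 0 (hC.zero_mem hne)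
  have hle : ∀ y ∈ C, ‖f y‖ ≤ u := fun y hy => by
    -- A scalar `c` of norm at most one rotates `f y` onto the nonnegative reals, so the bound on
    -- real parts becomes a bound on norms.
    obtain ⟨c, hc, hcy⟩ := RCLike.exists_norm_eq_mul_self (f y)
    have := hf (c • y) (hC.1.smul_mem hc.le hy)
    rw [map_smul, smul_eq_mul, ← hcy, RCLike.ofReal_re] at this
    exact this.le
  have hn : ‖((u⁻¹ : ℝ) : 𝕜)‖ = u⁻¹ := by
    rw [RCLike.norm_ofReal, abs_of_pos (inv_pos.2 hu0)]
  refine ⟨((u⁻¹ : ℝ) : 𝕜) • f, fun y hy => ?_, ?_⟩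
  · rw [smul_apply, norm_smul, hn, inv_mul_le_one₀ hu0]
    exact hle y hy
  · rw [smul_apply, norm_smul, hn, lt_inv_mul_iff₀ hu0, mul_one]
    exact hu.trans_le (RCLike.re_le_norm _)

/-- A linear functional on a space `G` of functionals that is dominated by the supremum over an
absolutely convex compact set is the evaluation at a point of this set. -/
theorem exists_eq_eval_of_bound_on_compact {G : Type*} [AddCommGroup G] [Module 𝕜 G]
    {D : Type*} [TopologicalSpace D] [CompactSpace D] [Nonempty D] (d : D → E)
    (hd : AbsConvex 𝕜 (Set.range d)) (J : G →ₗ[𝕜] E →ₗ[𝕜] 𝕜)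
    (hJ : ∀ g, Continuous fun w => J g (d w)) (f : G →ₗ[𝕜] 𝕜)
    (hf : ∀ g, (∀ w, ‖J g (d w)‖ ≤ 1) → ‖f g‖ ≤ 1) :
    ∃ w, ∀ g, f g = J g (d w) := by
  classical
  have : LocallyConvexSpace 𝕜 𝕜 := RCLike.locallyConvexSpace_self
  -- If the values of `f` on `s` were missed by the compact image in `s → 𝕜`, a functional `l` would
  -- separate them. As `l` is a combination of coordinates, it comes from one element of `G`, and
  -- this element violates `hf`.
  have hfin : ∀ s : Finset G, ∃ w, ∀ i ∈ s, J i (d w) = f i := by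
    intro s
    let L : E →ₗ[𝕜] (s → 𝕜) := LinearMap.pi fun i => J i
    by_contra hcon
    have hmem : (fun i : s => f i) ∉ L '' Set.range d := by
      rintro ⟨_, ⟨w, rfl⟩, hw⟩
      exact hcon ⟨w, fun i hi => congrFun hw ⟨i, hi⟩⟩
    have hcpt : IsCompact (L '' Set.range d) := by
      rw [← Set.range_comp]
      exact isCompact_range (continuous_pi fun i => hJ i)
    have hac : AbsConvex 𝕜 (L '' Set.range d) :=
      ⟨by
        rintro a ha _ ⟨_, ⟨y, hy, rfl⟩, rfl⟩
        exact ⟨a • y, hd.1.smul_mem ha hy, map_smul L a y⟩, hd.2.linear_image L⟩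
    obtain ⟨l, hl, hl1⟩ := hac.exists_strongDual_separating hcpt.isClosed
      ((Set.range_nonempty d).image L) hmem
    have hsum : ∀ y : s → 𝕜, l y = ∑ i, y i * l (Pi.single i 1) := fun y => by
      conv_lhs => rw [← Finset.univ_sum_single y, map_sum]
      refine Finset.sum_congr rfl fun i _ => ?_
      rw [← smul_eq_mul, ← map_smul, ← Pi.single_smul, smul_eq_mul, mul_one]
    have hg : ∀ (k : G →ₗ[𝕜] 𝕜), k (∑ i : s, l (Pi.single i 1) • (i : G)) = l fun i => k i := by
      intro k
      rw [hsum, map_sum]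
      exact Finset.sum_congr rfl fun i _ => by rw [map_smul, smul_eq_mul, mul_comm]
    refine hl1.not_ge ?_
    rw [← hg f]
    refine hf _ fun w => ?_
    have := hg (J.flip (d w))
    rw [LinearMap.flip_apply] at this
    rw [this]
    exact hl _ ⟨d w, ⟨w, rfl⟩, rfl⟩
  have hc : IsCompact (Set.range fun w => fun g => J g (d w)) :=
    isCompact_range (continuous_pi hJ)
  have : (fun g => f g) ∈ Set.range fun w => fun g => J g (d w) := by
    by_contra hn
    obtain ⟨s, u, hu, hsu⟩ := isOpen_pi_iff.1 hc.isClosed.isOpen_compl _ hn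
    obtain ⟨w, hw⟩ := hfin s
    refine hsu (a := fun g => J g (d w)) (fun i hi => ?_) ⟨w, rfl⟩
    simpa only [hw i hi] using (hu i hi).2
  obtain ⟨w, hw⟩ := this
  exact ⟨w, fun g => (congrFun hw g).symm⟩

end Separation

/-! ### Normable spaces and the Dixmier–Ng predual -/

section Normed

variable {𝕜 : Type} [RCLike 𝕜]

theorem isLCHausdorff_of_normedSpace (Y : Type*) [NormedAddCommGroup Y] [NormedSpace 𝕜 Y] :
    IsLCHausdorff 𝕜 (inferInstance : TopologicalSpace Y) where
  t2 := inferInstance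
  topologicalAddGroup := inferInstance
  continuousSMul := inferInstance
  locallyConvex := by
    let := NormedSpace.restrictScalars ℝ 𝕜 Y
    have : IsScalarTower ℝ 𝕜 Y := IsScalarTower.restrictScalars ℝ 𝕜 Y
    exact (locallyConvexSpace_rclike_iff_real (𝕜 := 𝕜)).2 inferInstance

theorem isNormInducing_comp_equiv {E : Type*} [AddCommGroup E] [Module 𝕜 E]
    (τ : TopologicalSpace E) {F : Type*} [NormedAddCommGroup F] [NormedSpace 𝕜 F]
    (e : E ≃L[𝕜] F) : IsNormInducing 𝕜 ((normSeminorm 𝕜 F).comp (e : E →ₗ[𝕜] F)) τ where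
  definite x hx := by
    have h : ‖e x‖ = 0 := hx
    simpa using h
  induces := by
    have := LinearMap.withSeminorms_induced (norm_withSeminorms 𝕜 F) (e : E →ₗ[𝕜] F)
    have h : τ = (inferInstance : TopologicalSpace F).induced (e : E →ₗ[𝕜] F) :=
      e.toHomeomorph.isInducing.eq_induced
    rw [← h] at this
    exact this

theorem isCompletelyNormable_of_equiv {E : Type*} [AddCommGroup E] [Module 𝕜 E]
    (τ : TopologicalSpace E) {F : Type*} [NormedAddCommGroup F] [NormedSpace 𝕜 F] [CompleteSpace F]
    (e : E ≃L[𝕜] F) : IsCompletelyNormable 𝕜 τ := by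
  refine ⟨_, isNormInducing_comp_equiv τ e, ?_⟩
  let p := (normSeminorm 𝕜 F).comp (e : E →ₗ[𝕜] F)
  let := p.toAddGroupSeminorm.toSeminormedAddCommGroup
  have hi : Isometry e := AddMonoidHomClass.isometry_of_norm e fun x => rfl
  exact (hi.isUniformInducing.completeSpace_congr e.surjective).2 inferInstance

/-- The normed group structure given by a seminorm which is a norm. -/
abbrev Seminorm.normedAddCommGroup {E : Type*} [AddCommGroup E] [Module 𝕜 E] (p : Seminorm 𝕜 E)
    (hp : ∀ x, p x = 0 → x = 0) : NormedAddCommGroup E :=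
  AddGroupNorm.toNormedAddCommGroup { p.toAddGroupSeminorm with eq_zero_of_map_eq_zero' := hp }

/-- The normed space structure given by a seminorm which is a norm. -/
abbrev Seminorm.normedSpace {E : Type*} [AddCommGroup E] [Module 𝕜 E] (p : Seminorm 𝕜 E)
    (hp : ∀ x, p x = 0 → x = 0) :
    @NormedSpace 𝕜 E _ (p.normedAddCommGroup hp).toSeminormedAddCommGroup :=
  let _ := p.normedAddCommGroup hp
  { norm_smul_le := fun a x => (map_smul_eq_mul p a x).le }

theorem topology_eq_moduleFilterBasis_normSeminorm (E : Type*) [SeminormedAddCommGroup E]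
    [NormedSpace 𝕜 E] : (inferInstance : TopologicalSpace E) =
      (SeminormFamily.moduleFilterBasis fun _ : Fin 1 => normSeminorm 𝕜 E).topology :=
  (norm_withSeminorms 𝕜 E).withSeminorms_eq

theorem IsNormInducing.topology_eq {E : Type*} [AddCommGroup E] [Module 𝕜 E] {p : Seminorm 𝕜 E}
    {τ : TopologicalSpace E} (h : IsNormInducing 𝕜 p τ) :
    τ = (p.normedAddCommGroup h.definite).toUniformSpace.toTopologicalSpace := by
  exact h.induces.withSeminorms_eq.trans (@topology_eq_moduleFilterBasis_normSeminorm 𝕜 _ E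
    (p.normedAddCommGroup h.definite).toSeminormedAddCommGroup (p.normedSpace h.definite)).symm

theorem IsCompletelyNormable.exists_normed {E : Type*} [AddCommGroup E] [Module 𝕜 E]
    {τ : TopologicalSpace E} (h : IsCompletelyNormable 𝕜 τ) :
    ∃ (p : Seminorm 𝕜 E) (hp : ∀ x, p x = 0 → x = 0),
      τ = (p.normedAddCommGroup hp).toUniformSpace.toTopologicalSpace ∧
      @CompleteSpace E (p.normedAddCommGroup hp).toUniformSpace := by
  obtain ⟨p, hp, hc⟩ := h
  exact ⟨p, hp.definite, hp.topology_eq, hc⟩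

/-- The functionals on `X` which are continuous for the topology of `D`, where `d : D → X`. -/
def dualContinuousOn {X D : Type*} [NormedAddCommGroup X] [NormedSpace 𝕜 X] [TopologicalSpace D]
    (d : D → X) : Submodule 𝕜 (StrongDual 𝕜 X) where
  carrier := {g | Continuous fun w => g (d w)}
  zero_mem' := continuous_const
  add_mem' := fun hf hg => hf.add hg
  smul_mem' := fun c _ hf => hf.const_smul c

/-- Norm convergence of functionals is uniform on the unit ball, and uniform limits of continuous
functions are continuous. -/
theorem isClosed_dualContinuousOn {X D : Type*} [NormedAddCommGroup X] [NormedSpace 𝕜 X]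
    [TopologicalSpace D] (d : D → X) (hd : ∀ w, ‖d w‖ ≤ 1) :
    IsClosed (dualContinuousOn (𝕜 := 𝕜) d : Set (StrongDual 𝕜 X)) := by
  refine isClosed_of_closure_subset fun f hf => ?_
  refine continuous_of_uniform_approx_of_continuous fun u hu => ?_
  obtain ⟨ε, hε, hu⟩ := Metric.mem_uniformity_dist.1 hu
  obtain ⟨g, hg, hfg⟩ := Metric.mem_closure_iff.1 hf ε hε
  refine ⟨fun w => g (d w), hg, fun w => hu ?_⟩
  rw [dist_eq_norm] at hfg ⊢
  exact ((f - g).le_of_opNorm_le_of_le le_rfl (hd w)).trans_lt (by simpa using hfg)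

/-- A normed space whose unit ball is the image of a compact space is the dual of the space of
functionals that are continuous on this compact space if these functionals are norming. -/
theorem nonempty_equiv_strongDual_of_compact {X Y D : Type*} [NormedAddCommGroup X]
    [NormedSpace 𝕜 X] [NormedAddCommGroup Y] [NormedSpace 𝕜 Y] [TopologicalSpace D]
    [CompactSpace D] (d : D → X) (hd : Set.range d = Metric.closedBall 0 1)
    (ι : Y →ₗᵢ[𝕜] StrongDual 𝕜 X) (hι : ∀ g, Continuous fun w => ι g (d w))
    (hsep : ∀ x : X, 1 < ‖x‖ → ∃ g, ‖g‖ ≤ 1 ∧ 1 < ‖ι g x‖) :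
    Nonempty (X ≃L[𝕜] StrongDual 𝕜 Y) := by
  let T : X →L[𝕜] StrongDual 𝕜 Y := ι.toContinuousLinearMap.flip
  have hT : ∀ x (g : Y), T x g = ι g x := fun x g => rfl
  have hnorm : ∀ x, ‖T x‖ = ‖x‖ := by
    intro x
    refine le_antisymm (ContinuousLinearMap.opNorm_le_bound _ (norm_nonneg _) fun g => ?_) ?_
    · rw [hT, mul_comm]
      exact (ι g).le_of_opNorm_le (ι.norm_map g).le x
    · by_contra! hlt
      -- Dividing `x` by an intermediate `r` gives a vector of norm above one, to which `hsep`
      -- applies.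
      obtain ⟨r, hr, hrx⟩ := exists_between hlt
      have hr0 : 0 < r := (norm_nonneg _).trans_lt hr
      have hn : ‖((r⁻¹ : ℝ) : 𝕜)‖ = r⁻¹ := by
        rw [RCLike.norm_ofReal, abs_of_pos (inv_pos.2 hr0)]
      obtain ⟨g, hg1, hgx⟩ := hsep (((r⁻¹ : ℝ) : 𝕜) • x) (by
        rw [norm_smul, hn, lt_inv_mul_iff₀ hr0, mul_one]
        exact hrx)
      rw [map_smul, norm_smul, hn, lt_inv_mul_iff₀ hr0, mul_one] at hgx
      have := (T x).le_opNorm g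
      have h2 : ‖T x‖ * ‖(g : Y)‖ ≤ ‖T x‖ * 1 :=
        mul_le_mul_of_nonneg_left hg1 (norm_nonneg _)
      have h3 : ‖T x g‖ = ‖ι g x‖ := rfl
      linarith
  have hne : Nonempty D := Set.range_nonempty_iff_nonempty.1 (by rw [hd]; exact ⟨0, by simp⟩)
  have hac : AbsConvex 𝕜 (Set.range d) := by
    rw [hd]
    let := NormedSpace.restrictScalars ℝ 𝕜 X
    have : IsScalarTower ℝ 𝕜 X := IsScalarTower.restrictScalars ℝ 𝕜 X
    exact ⟨balanced_closedBall_zero, convex_RCLike_iff_convex_real.2 (convex_closedBall 0 1)⟩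
  let J : Y →ₗ[𝕜] X →ₗ[𝕜] 𝕜 := (ContinuousLinearMap.coeLM 𝕜).comp ι.toLinearMap
  have hsurj : Function.Surjective T := by
    intro f
    -- Normalising by `‖f‖ + 1` instead of `‖f‖` covers `f = 0`.
    have hc : (0 : ℝ) < ‖f‖ + 1 := by positivity
    have hn : ‖(((‖f‖ + 1)⁻¹ : ℝ) : 𝕜)‖ = (‖f‖ + 1)⁻¹ := by
      rw [RCLike.norm_ofReal, abs_of_pos (inv_pos.2 hc)]
    obtain ⟨w, hw⟩ := exists_eq_eval_of_bound_on_compact d hac J hι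
      ((((‖f‖ + 1)⁻¹ : ℝ) : 𝕜) • (f : Y →ₗ[𝕜] 𝕜)) (by
        intro g hg
        have hg1 : ‖g‖ ≤ 1 := by
          rw [← ι.norm_map]
          refine (ι g).opNorm_le_of_unit_norm zero_le_one fun x hx => ?_
          obtain ⟨w, rfl⟩ : x ∈ Set.range d := hd ▸ by simp [hx]
          exact hg w
        rw [LinearMap.smul_apply, norm_smul, hn, inv_mul_le_one₀ hc]
        exact (f.le_of_opNorm_le_of_le le_rfl hg1).trans (by linarith))
    refine ⟨(((‖f‖ + 1 : ℝ)) : 𝕜) • d w, ?_⟩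
    ext g
    have := hw g
    rw [map_smul, smul_apply, hT]
    change _ • (J g) (d w) = _
    rw [← this, LinearMap.smul_apply, smul_smul, ← RCLike.ofReal_mul, mul_inv_cancel₀ hc.ne']
    simp
  exact ⟨(LinearIsometryEquiv.ofSurjective ⟨T.toLinearMap, hnorm⟩ hsurj).toContinuousLinearEquiv⟩

end Normed

/-! ### Absolutely convex sets -/

section AbsConvexAux

variable {𝕜 : Type*} [RCLike 𝕜] {E : Type*} [AddCommGroup E] [Module 𝕜 E]

theorem Seminorm.absConvex_closedBall (p : Seminorm 𝕜 E) (r : ℝ) :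
    AbsConvex 𝕜 (p.closedBall 0 r) := by
  let : Module ℝ E := Module.restrictScalars ℝ 𝕜 E
  have : IsScalarTower ℝ 𝕜 E := IsScalarTower.restrictScalars ℝ 𝕜 E
  exact ⟨p.balanced_closedBall_zero r, convex_RCLike_iff_convex_real.2 (p.convex_closedBall 0 r)⟩

theorem AbsConvex.smul {C : Set E} (hC : AbsConvex 𝕜 C) (c : 𝕜) : AbsConvex 𝕜 (c • C) :=
  ⟨hC.1.smul c, hC.2.smul c⟩

theorem AbsConvex.add_half_smul_mem {C : Set E} (hC : AbsConvex 𝕜 C) {x y : E} (hx : x ∈ C)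
    (hy : y ∈ C) : (2⁻¹ : 𝕜) • x + (2⁻¹ : 𝕜) • y ∈ C := by
  have h : (0 : 𝕜) ≤ 2⁻¹ := inv_nonneg.2 zero_le_two
  exact hC.2 hx hy h h (by norm_num)

/-- Removing the term `k = 0` leaves half of a shorter sum of the same kind, so the whole is a
midpoint of two points of `C`. -/
theorem AbsConvex.sum_inv_two_pow_smul_mem {C : Set E} (hC : AbsConvex 𝕜 C) (h0 : (0 : E) ∈ C)
    (n : ℕ) (w : ℕ → E) (hw : ∀ k < n, w k ∈ C) :
    ∑ k ∈ Finset.range n, ((2⁻¹ : 𝕜) ^ (k + 1)) • w k ∈ C := by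
  induction n generalizing w with
  | zero => simpa using h0
  | succ n ih =>
    rw [Finset.sum_range_succ']
    have h := hC.add_half_smul_mem (ih (fun k => w (k + 1)) fun k hk => hw _ (by omega))
      (hw 0 (by omega))
    rw [Finset.smul_sum] at h
    simpa only [smul_smul, ← pow_succ', zero_add, pow_one] using h

end AbsConvexAux

/-! ### The mixed topology and its bounded sets -/

section Mixed

variable {𝕜 : Type} [RCLike 𝕜] {E : Type u} [AddCommGroup E] [Module 𝕜 E]

/-- The sets `2⁻¹ ^ (k + 1) • W`, for a disk `W` inside `V`, have all their finite sums in `W`,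
whatever `B` is. -/
theorem exists_isDiskNhdSeq_mixedSet_subset [τ' : TopologicalSpace E] (h : IsLCHausdorff 𝕜 τ')
    {V : Set E} (hV : V ∈ 𝓝 (0 : E)) :
    ∃ U : ℕ → Set E, IsDiskNhdSeq 𝕜 τ' U ∧ ∀ B, mixedSet U B ⊆ V := by
  have := h.continuousSMul
  have := h.locallyConvex
  obtain ⟨W, ⟨hW0, hW⟩, hWV⟩ := (nhds_hasBasis_absConvex 𝕜 E).mem_iff.1 hV
  refine ⟨fun k => ((2⁻¹ : 𝕜) ^ (k + 1)) • W, fun k => ⟨hW.smul _, ?_⟩, fun B x hx => hWV ?_⟩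
  · exact (set_smul_mem_nhds_zero_iff (by simp)).2 hW0
  · obtain ⟨n, hn⟩ := Set.mem_iUnion.1 hx
    obtain ⟨v, hv, rfl⟩ := (Set.mem_finsetSum _ _ _).1 hn
    have : ∀ k, ∃ w, k < n + 1 → w ∈ W ∧ v k = ((2⁻¹ : 𝕜) ^ (k + 1)) • w := fun k => by
      by_cases hk : k < n + 1
      · obtain ⟨w, hw, he⟩ := (hv (Finset.mem_range.2 hk)).1
        exact ⟨w, fun _ => ⟨hw, he.symm⟩⟩
      · exact ⟨0, fun h => (hk h).elim⟩
    choose w hw using this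
    rw [Finset.sum_congr rfl fun k hk => (hw k (Finset.mem_range.1 hk)).2]
    exact hW.sum_inv_two_pow_smul_mem (mem_of_mem_nhds hW0) _ w fun k hk => (hw k hk).1

/-- The mixed topology is finer than the coarser one of the given topologies. -/
theorem mixedTopology_le (τ τ' : TopologicalSpace E) (h : IsLCHausdorff 𝕜 τ') :
    mixedTopology 𝕜 τ τ' ≤ τ' := by
  intro O hO x hx B _
  have := h.topologicalAddGroup
  have hx0 : (fun y => x + y) ⁻¹' O ∈ @nhds E τ' 0 := by
    refine (continuous_const_add x).continuousAt.preimage_mem_nhds ?_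
    rw [add_zero]
    exact @IsOpen.mem_nhds E τ' x O hO hx
  obtain ⟨U, hU, hUB⟩ := exists_isDiskNhdSeq_mixedSet_subset h hx0
  exact ⟨U, hU, fun y hy => hUB B hy⟩

theorem exists_mixedSet_subset_of_mem_nhds {τ τ' : TopologicalSpace E} {V : Set E}
    (hV : V ∈ @nhds E (mixedTopology 𝕜 τ τ') 0) {B : ℕ → Set E} (hB : IsMixedBasis 𝕜 τ τ' B) :
    ∃ U : ℕ → Set E, IsDiskNhdSeq 𝕜 τ' U ∧ mixedSet U B ⊆ V := by
  obtain ⟨O, hOV, hO, h0⟩ := (@mem_nhds_iff E (mixedTopology 𝕜 τ τ') 0 V).1 hV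
  obtain ⟨U, hU, hUO⟩ := hO 0 h0 B hB
  exact ⟨U, hU, fun y hy => hOV (by simpa using hUO y hy)⟩

theorem inter_subset_mixedSet {τ τ' : TopologicalSpace E} {U B : ℕ → Set E}
    (hB : IsMixedBasis 𝕜 τ τ' B) (hU : IsDiskNhdSeq 𝕜 τ' U) (n : ℕ) :
    U n ∩ B n ⊆ mixedSet U B := by
  have h0 : ∀ k, (0 : E) ∈ U k ∩ B k := fun k =>
    ⟨@mem_of_mem_nhds E τ' 0 _ (hU k).2, (hB.absConvex k).zero_mem (hB.nonempty k)⟩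
  intro x hx
  refine Set.mem_iUnion.2 ⟨n, (Set.mem_finsetSum _ _ _).2 ⟨Pi.single n x, ?_, ?_⟩⟩
  · intro k _
    by_cases hk : k = n
    · subst hk; simpa using hx
    · simpa [Pi.single_eq_of_ne hk] using h0 k
  · rw [Finset.sum_pi_single', if_pos (by simp)]

/-- A `γ`-neighbourhood of zero contains some `U n ∩ B n` with `S ⊆ B n`. Here `B n` absorbs `S`
because it is balanced, and `U n` does because `τ'` is coarser than `τ`. -/
theorem isBddFor_mixedTopology {τ τ' : TopologicalSpace E} (hle : τ ≤ τ') {B : ℕ → Set E}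
    (hB : IsMixedBasis 𝕜 τ τ' B) {S : Set E} (hS : IsBddFor 𝕜 τ S) :
    IsBddFor 𝕜 (mixedTopology 𝕜 τ τ') S := by
  intro V hV
  obtain ⟨U, hU, hUV⟩ := exists_mixedSet_subset_of_mem_nhds hV hB
  obtain ⟨n, hn⟩ := hB.basis S hS
  have h1 : Absorbs 𝕜 (U n) S := (IsVonNBounded.of_topologicalSpace_le hle hS) (hU n).2
  refine Absorbs.mono_left ?_ ((inter_subset_mixedSet hB hU n).trans hUV)
  have h2 : Absorbs 𝕜 (B n) S := by
    refine Absorbs.mono_right ?_ hn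
    exact (hB.absConvex n).1.absorbs_self
  exact h1.inter h2

theorem LinearMap.preimage_ball_mem_nhds_zero [TopologicalSpace E] (g : E →ₗ[𝕜] 𝕜)
    (hg : Continuous g) {ε : ℝ} (hε : 0 < ε) : g ⁻¹' Metric.ball 0 ε ∈ 𝓝 (0 : E) :=
  hg.continuousAt.preimage_mem_nhds (by rw [map_zero]; exact Metric.ball_mem_nhds 0 hε)

/-- A functional which is continuous for the mixed topology is continuous for the coarser topology
on bounded sets. -/
theorem continuous_comp_of_mixedTopology {τ τ' : TopologicalSpace E} (h : IsLCHausdorff 𝕜 τ')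
    {B : ℕ → Set E} (hB : IsMixedBasis 𝕜 τ τ' B) {D : Type*} [TopologicalSpace D] {d : D → E}
    (hd : @Continuous D E _ τ' d) (hbdd : IsBddFor 𝕜 τ (Set.range d)) (g : E →ₗ[𝕜] 𝕜)
    (hg : @Continuous E 𝕜 (mixedTopology 𝕜 τ τ') _ g) : Continuous fun w => g (d w) := by
  have := h.topologicalAddGroup
  obtain ⟨n, hn⟩ := hB.basis _ hbdd
  refine continuous_iff_continuousAt.2 fun w => Metric.tendsto_nhds.2 fun ε hε => ?_
  have hV : g ⁻¹' Metric.ball 0 ε ∈ @nhds E (mixedTopology 𝕜 τ τ') 0 :=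
    @LinearMap.preimage_ball_mem_nhds_zero 𝕜 _ E _ _ (mixedTopology 𝕜 τ τ') g hg ε hε
  obtain ⟨U, hU, hUV⟩ := exists_mixedSet_subset_of_mem_nhds hV hB
  have hsub : Continuous fun v => d v - d w := hd.sub continuous_const
  have hev : ∀ᶠ v in 𝓝 w, d v - d w ∈ U (n + 1) :=
    hsub.continuousAt.eventually_mem (by rw [sub_self]; exact (hU (n + 1)).2)
  filter_upwards [hev] with v hv
  -- The difference of two points of the disk `B n` lies in `2 • B n`; hence the passage to index `n
  -- + 1`.
  have hmem : d v - d w ∈ B (n + 1) := by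
    refine hB.double_subset n ⟨_, (hB.absConvex n).add_half_smul_mem (hn ⟨v, rfl⟩)
      (((hB.absConvex n).1.neg_mem_iff).2 (hn ⟨w, rfl⟩)), ?_⟩
    simp [smul_smul, sub_eq_add_neg]
  have := hUV (inter_subset_mixedSet hB hU (n + 1) ⟨hv, hmem⟩)
  rw [Set.mem_preimage, mem_ball_zero_iff, map_sub] at this
  rwa [dist_eq_norm]

theorem IsNormInducing.isBddFor_iff {p : Seminorm 𝕜 E} {τ : TopologicalSpace E}
    (hp : IsNormInducing 𝕜 p τ) {S : Set E} :
    IsBddFor 𝕜 τ S ↔ ∃ r > 0, S ⊆ p.closedBall 0 r := by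
  refine hp.induces.isVonNBounded_iff_seminorm_bounded.trans ⟨fun h => ?_, fun ⟨r, hr, h⟩ _ => ?_⟩
  · obtain ⟨r, hr, h⟩ := h 0
    exact ⟨r, hr, fun x hx => by simpa using (h x hx).le⟩
  · exact ⟨r + 1, by positivity, fun x hx => by
      have := h hx
      rw [Seminorm.mem_closedBall_zero] at this
      linarith⟩

/-- In a normed space, (BBCl) gives a basis of bounded sets as in the definition of the mixed
topology. -/
theorem IsNormInducing.exists_isMixedBasis {p : Seminorm 𝕜 E} {τ τ' : TopologicalSpace E}
    (hp : IsNormInducing 𝕜 p τ) (h : SatisfiesBBCl 𝕜 τ τ') :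
    ∃ B : ℕ → Set E, IsMixedBasis 𝕜 τ τ' B := by
  choose! K hSK hK hKb hKc using h
  have hball : ∀ r, IsBddFor 𝕜 τ (p.closedBall 0 r) := fun r =>
    hp.isBddFor_iff.2 ⟨max r 1, by positivity, p.closedBall_mono (le_max_left _ _)⟩
  let next : ℕ → Set E → Set E := fun n C => (2 : 𝕜) • C ∪ p.closedBall 0 n
  have hnext : ∀ n C, IsBddFor 𝕜 τ C → IsBddFor 𝕜 τ (next n C) := by
    intro n C hC
    obtain ⟨r, hr, hC⟩ := hp.isBddFor_iff.1 hC
    refine hp.isBddFor_iff.2 ⟨max (2 * r) n, by positivity, Set.union_subset ?_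
      (p.closedBall_mono (le_max_right _ _))⟩
    rintro _ ⟨x, hx, rfl⟩
    have := hC hx
    rw [Seminorm.mem_closedBall_zero] at this ⊢
    refine le_max_of_le_left ?_
    simp only [map_smul_eq_mul, RCLike.norm_ofNat]
    linarith
  -- Stage `n + 1` swallows the ball of radius `n`, which makes the family a basis, and twice the
  -- preceding set.
  let B : ℕ → Set E := fun n => Nat.rec (K (p.closedBall 0 0)) (fun n C => K (next n C)) n
  have hBb : ∀ n, IsBddFor 𝕜 τ (B n) := fun n => by
    induction n with
    | zero => exact hKb _ (hball 0)
    | succ n ih => exact hKb _ (hnext _ _ ih)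
  have hBK : ∀ n, ∃ S, IsBddFor 𝕜 τ S ∧ (0 : E) ∈ S ∧ B n = K S := fun n => by
    cases n with
    | zero => exact ⟨_, hball 0, by simp, rfl⟩
    | succ n => exact ⟨_, hnext n _ (hBb n), Or.inr (by simp), rfl⟩
  refine ⟨B, fun n => ?_, fun n => ?_, hBb, fun n => ?_, fun n => ?_, fun S hS => ?_⟩
  · obtain ⟨S, hS, h0, he⟩ := hBK n
    exact ⟨0, he ▸ hSK S hS h0⟩
  · obtain ⟨S, hS, h0, he⟩ := hBK n
    exact he ▸ hK S hS
  · obtain ⟨S, hS, h0, he⟩ := hBK n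
    exact he ▸ hKc S hS
  · exact Set.subset_union_left.trans (hSK _ (hnext n _ (hBb n)))
  · obtain ⟨r, -, hr⟩ := hp.isBddFor_iff.1 hS
    obtain ⟨n, hn⟩ := exists_nat_ge r
    exact ⟨n + 1, (hr.trans (p.closedBall_mono hn)).trans
      (Set.subset_union_right.trans (hSK _ (hnext n _ (hBb n))))⟩

/-- The set of points on which a sequence of functionals which tends to zero uniformly on bounded
sets is bounded by some `r < 1` is open in the mixed topology. -/
theorem isOpen_mixedTopology_setOf_norm_le {p : Seminorm 𝕜 E} {τ τ' : TopologicalSpace E}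
    (hp : IsNormInducing 𝕜 p τ) (g : ℕ → E →ₗ[𝕜] 𝕜) (hg : ∀ n, @Continuous E 𝕜 τ' _ (g n))
    (hgp : ∀ n x, ‖g n x‖ ≤ (1 / 2) ^ n * p x) :
    IsOpen[mixedTopology 𝕜 τ τ'] {x | ∃ r < 1, ∀ n, ‖g n x‖ ≤ r} := by
  rintro x ⟨r, hr, hx⟩ B hB
  -- The bound `r` is strictly below one, so a perturbation of total size `ε` still leaves room;
  -- this makes the set open at each of its points.
  let ε : ℝ := (1 - r) / 2
  have hε : 0 < ε := by simp only [ε]; linarith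
  choose c hc hBc using fun k => hp.isBddFor_iff.1 (hB.bounded k)
  -- On `B k` all functionals of index at least `N k` are automatically small, so `U k` has to
  -- control only finitely many of them.
  have hN : ∀ k, ∃ N : ℕ, ∀ n ≥ N, (1 / 2 : ℝ) ^ n * c k ≤ ε * (1 / 2) ^ (k + 1) := by
    intro k
    have ht : Tendsto (fun n : ℕ => (1 / 2 : ℝ) ^ n * c k) atTop (𝓝 0) := by
      simpa using (tendsto_pow_atTop_nhds_zero_of_lt_one (r := (1 / 2 : ℝ)) (by norm_num)
        (by norm_num)).mul_const (c k)
    exact eventually_atTop.1 (ht.eventually_le_const (by positivity))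
  choose N hN using hN
  let q : ℕ → Seminorm 𝕜 E := fun n => (normSeminorm 𝕜 𝕜).comp (g n)
  let U : ℕ → Set E := fun k => ⋂ n ∈ Finset.range (N k), (q n).closedBall 0 (ε * (1 / 2) ^ (k + 1))
  have hle : ∀ k, ∀ y ∈ U k ∩ B k, ∀ n, ‖g n y‖ ≤ ε * (1 / 2) ^ (k + 1) := by
    rintro k y ⟨hyU, hyB⟩ n
    by_cases hn : n < N k
    · have := Set.mem_iInter₂.1 hyU n (Finset.mem_range.2 hn)
      rwa [Seminorm.mem_closedBall_zero] at this
    · have := hBc k hyB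
      rw [Seminorm.mem_closedBall_zero] at this
      exact (hgp n y).trans ((mul_le_mul_of_nonneg_left this (by positivity)).trans
        (hN k n (not_lt.1 hn)))
  refine ⟨U, fun k => ⟨AbsConvex.iInter₂ fun n _ => (q n).absConvex_closedBall _, ?_⟩, ?_⟩
  · refine (Filter.biInter_finset_mem _).2 fun n _ => ?_
    have : (fun y => ‖g n y‖) ⁻¹' Set.Iio (ε * (1 / 2) ^ (k + 1)) ∈ @nhds E τ' 0 := by
      refine (@Continuous.continuousAt _ _ τ' _ _ 0
      (continuous_norm.comp (hg n))).preimage_mem_nhds ?_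
      simp only [Function.comp_apply, map_zero, norm_zero]
      exact Iio_mem_nhds (by positivity)
    filter_upwards [this] with y hy
    rw [Seminorm.mem_closedBall_zero]
    exact (Set.mem_Iio.1 hy).le
  · intro y hy
    obtain ⟨m, hm⟩ := Set.mem_iUnion.1 hy
    obtain ⟨v, hv, rfl⟩ := (Set.mem_finsetSum _ _ _).1 hm
    refine ⟨r + ε, by simp only [ε]; linarith, fun n => ?_⟩
    rw [map_add, map_sum]
    refine (norm_add_le _ _).trans (add_le_add (hx n) ?_)
    refine (norm_sum_le_of_le _ fun k hk => hle k (v k) (hv hk) n).trans ?_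
    rw [← Finset.mul_sum]
    refine mul_le_of_le_one_right hε.le ?_
    simp only [pow_succ, ← Finset.sum_mul]
    have := geom_sum_eq (x := (1 / 2 : ℝ)) (by norm_num) (m + 1)
    have h0 : (0 : ℝ) < (1 / 2) ^ (m + 1) := by positivity
    rw [this, show (1 / 2 - 1 : ℝ) = -(1 / 2) by norm_num, div_neg, div_div_eq_mul_div]
    linarith

/-- If the closed unit ball is closed for `τ'`, the `τ'`-continuous functionals are norming. -/
theorem exists_continuous_of_isClosed_closedBall {p : Seminorm 𝕜 E} {τ' : TopologicalSpace E}
    (hp : ∀ x, p x = 0 → x = 0) (h : IsLCHausdorff 𝕜 τ')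
    (hcl : @IsClosed E τ' (p.closedBall 0 1)) {x : E} {r : ℝ} (hr : 0 < r) (hx : r < p x) :
    ∃ g : E →ₗ[𝕜] 𝕜, @Continuous E 𝕜 τ' _ g ∧ (∀ y, ‖g y‖ ≤ p y) ∧ r < ‖g x‖ := by
  have := h.topologicalAddGroup
  have := h.continuousSMul
  have := h.locallyConvex
  have hn : ∀ t : ℝ, 0 < t → ‖((t⁻¹ : ℝ) : 𝕜)‖ = t⁻¹ := fun t ht => by
    rw [RCLike.norm_ofReal, abs_of_pos (inv_pos.2 ht)]
  have hxr : ((r⁻¹ : ℝ) : 𝕜) • x ∉ p.closedBall 0 1 := by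
    rw [Seminorm.mem_closedBall_zero, map_smul_eq_mul, hn r hr, not_le, lt_inv_mul_iff₀ hr, mul_one]
    exact hx
  obtain ⟨g, hg, hgx⟩ := (p.absConvex_closedBall 1).exists_strongDual_separating hcl
    ⟨0, by simp⟩ hxr
  refine ⟨g, g.continuous, fun y => ?_, ?_⟩
  · rcases (apply_nonneg p y).eq_or_lt with h0 | h0
    · simp [hp y h0.symm]
    · have := hg ((((p y)⁻¹ : ℝ) : 𝕜) • y) (by
        rw [Seminorm.mem_closedBall_zero, map_smul_eq_mul, hn _ h0, inv_mul_cancel₀ h0.ne'])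
      rw [map_smul, norm_smul, hn _ h0, inv_mul_le_one₀ h0] at this
      exact this
  · rw [map_smul, norm_smul, hn r hr, lt_inv_mul_iff₀ hr, mul_one] at hgx
    exact hgx

/-- If the closed unit ball is closed for `τ'`, sets which are bounded for the mixed topology are
bounded for the norm. -/
theorem isBddFor_of_isBddFor_mixedTopology {p : Seminorm 𝕜 E} {τ τ' : TopologicalSpace E}
    (hp : IsNormInducing 𝕜 p τ) (h : IsLCHausdorff 𝕜 τ') (hcl : @IsClosed E τ' (p.closedBall 0 1))
    {S : Set E} (hS : IsBddFor 𝕜 (mixedTopology 𝕜 τ τ') S) : IsBddFor 𝕜 τ S := by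
  by_contra hcon
  rw [hp.isBddFor_iff] at hcon
  push Not at hcon
  -- Norms above `(n + 1) * 2 ^ n` leave a value above `n` after the functional is scaled by `2⁻¹ ^
  -- n`.
  have hsep : ∀ n : ℕ, ∃ x ∈ S, ∃ g : E →ₗ[𝕜] 𝕜, @Continuous E 𝕜 τ' _ g ∧
      (∀ y, ‖g y‖ ≤ (1 / 2) ^ n * p y) ∧ (n : ℝ) < ‖g x‖ := by
    intro n
    have hn : ‖(2⁻¹ : 𝕜) ^ n‖ = (1 / 2) ^ n := by simp
    have hR : (0 : ℝ) < (n + 1) * 2 ^ n := by positivity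
    obtain ⟨x, hxS, hx⟩ := Set.not_subset.1 (hcon _ hR)
    rw [Seminorm.mem_closedBall_zero, not_le] at hx
    obtain ⟨f, hf, hfp, hfx⟩ :=
      exists_continuous_of_isClosed_closedBall hp.definite h hcl hR hx
    refine ⟨x, hxS, ((2⁻¹ : 𝕜) ^ n) • f,
      (continuous_const_smul ((2⁻¹ : 𝕜) ^ n)).comp hf, fun y => ?_, ?_⟩
    · rw [LinearMap.smul_apply, norm_smul, hn]
      exact mul_le_mul_of_nonneg_left (hfp y) (by positivity)
    · rw [LinearMap.smul_apply, norm_smul, hn]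
      have h2 : (1 / 2 : ℝ) ^ n * ((n + 1) * 2 ^ n) = n + 1 := by
        rw [mul_left_comm, ← mul_pow]
        norm_num
      have h3 := mul_lt_mul_of_pos_left hfx (by positivity : (0 : ℝ) < (1 / 2) ^ n)
      linarith
  choose x hxS g hg hgp hgx using hsep
  have hO := isOpen_mixedTopology_setOf_norm_le (τ' := τ') hp g hg hgp
  -- Absorption gives one scalar `a` with every `‖g n (x n)‖ ≤ ‖a‖`, contradicting `n < ‖g n (x n)‖`
  -- for large `n`.
  have habs := hS (@IsOpen.mem_nhds E (mixedTopology 𝕜 τ τ') 0 _ hO ⟨0, by simp, by simp⟩)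
  obtain ⟨a, ha⟩ := habs.exists
  obtain ⟨n, hn⟩ := exists_nat_ge ‖a‖
  obtain ⟨y, ⟨r, hr, hy⟩, hxy⟩ := ha (hxS n)
  have h1 := hgx n
  rw [← hxy, map_smul, norm_smul] at h1
  have h2 : ‖a‖ * ‖g n y‖ ≤ ‖a‖ * 1 := mul_le_mul_of_nonneg_left ((hy n).trans hr.le) (norm_nonneg _)
  linarith

end Mixed

/-! ### Compact unit balls, preduals and semi-reflexivity -/

section Implications

variable {𝕜 : Type} [RCLike 𝕜] {E : Type u} [AddCommGroup E] [Module 𝕜 E]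

/-- Parametrising `K` by a compact space `D` removes the second topology from `E`: continuity on `K`
becomes continuity on `D`, and `E` can carry its norm topology. -/
theorem IsCompact.exists_compactSpace_range_eq {E : Type u} [TopologicalSpace E] {K : Set E}
    (hK : IsCompact K) : ∃ (D : Type u) (_ : TopologicalSpace D) (_ : CompactSpace D) (d : D → E),
      Continuous d ∧ Set.range d = K :=
  ⟨K, inferInstance, isCompact_iff_compactSpace.1 hK, Subtype.val, continuous_subtype_val,
    Subtype.range_coe⟩

theorem isCompact_induced_of_isCompact_image {E F : Type*} [t : TopologicalSpace F] {f : E → F}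
    {K : Set E} (h : IsCompact (f '' K)) : @IsCompact E (t.induced f) K := by
  let := t.induced f
  exact (Topology.IsInducing.mk rfl).isCompact_iff.2 h

theorem isLCHausdorff_induced_pi {ι : Type*} (L : E →ₗ[𝕜] ι → 𝕜) (hL : Function.Injective L) :
    IsLCHausdorff 𝕜 ((inferInstance : TopologicalSpace (ι → 𝕜)).induced L) := by
  have : LocallyConvexSpace 𝕜 𝕜 := RCLike.locallyConvexSpace_self
  let := (inferInstance : TopologicalSpace (ι → 𝕜)).induced L
  exact ⟨.of_injective_continuous hL continuous_induced_dom, topologicalAddGroup_induced L,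
    continuousSMul_induced L, .induced L⟩

theorem HasBanachPredual.exists_normed {τ : TopologicalSpace E} (h : HasBanachPredual 𝕜 τ) :
    ∃ (Y : Type u) (_ : NormedAddCommGroup Y) (_ : NormedSpace 𝕜 Y),
      CompleteSpace Y ∧ Nonempty (E ≃L[𝕜] StrongDual 𝕜 Y) := by
  obtain ⟨Y, _, _, σ, -, hσ, he⟩ := h
  obtain ⟨p, hp, rfl, hc⟩ := hσ.exists_normed
  exact ⟨Y, p.normedAddCommGroup hp, p.normedSpace hp, hc, he⟩

theorem HasBanachPredual.isCompletelyNormable {τ : TopologicalSpace E}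
    (h : HasBanachPredual 𝕜 τ) : IsCompletelyNormable 𝕜 τ := by
  obtain ⟨Y, _, _, -, ⟨e⟩⟩ := h.exists_normed
  exact isCompletelyNormable_of_equiv τ e

theorem isCompletelyNormable_of_completeSpace (Y : Type*) [NormedAddCommGroup Y] [NormedSpace 𝕜 Y]
    [CompleteSpace Y] : IsCompletelyNormable 𝕜 (inferInstance : TopologicalSpace Y) :=
  isCompletelyNormable_of_equiv _ (ContinuousLinearEquiv.refl 𝕜 Y)

theorem HasBanachPredual.exists_isCompact_closedBall {τ : TopologicalSpace E}
    (h : HasBanachPredual 𝕜 τ) : ∃ p : Seminorm 𝕜 E, IsNormInducing 𝕜 p τ ∧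
      ∃ τ' : TopologicalSpace E, IsLCHausdorff 𝕜 τ' ∧ @IsCompact E τ' (p.closedBall 0 1) := by
  obtain ⟨Y, _, _, -, ⟨e⟩⟩ := h.exists_normed
  -- The topology pulled back along `L` is the weak* topology transported to `E`.
  let L : E →ₗ[𝕜] Y → 𝕜 := LinearMap.pi fun y => (LinearMap.applyₗ y).comp
    ((ContinuousLinearMap.coeLM 𝕜).comp (e : E →ₗ[𝕜] StrongDual 𝕜 Y))
  have hL : ∀ x y, L x y = e x y := fun x y => rfl
  have hinj : Function.Injective L := fun x x' hx => e.injective (by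
    ext y
    rw [← hL, hx, hL])
  refine ⟨_, isNormInducing_comp_equiv τ e, _, isLCHausdorff_induced_pi L hinj, ?_⟩
  refine isCompact_induced_of_isCompact_image ?_
  have himg : L '' (((normSeminorm 𝕜 (StrongDual 𝕜 Y)).comp (e : E →ₗ[𝕜] _)).closedBall 0 1) =
      (fun (φ : WeakDual 𝕜 Y) y => φ y) ''
        (WeakDual.toStrongDual ⁻¹' Metric.closedBall (0 : StrongDual 𝕜 Y) 1) := by
    ext F
    constructor
    · rintro ⟨x, hx, rfl⟩
      refine ⟨StrongDual.toWeakDual (e x), ?_, rfl⟩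
      rw [Seminorm.mem_closedBall_zero] at hx
      simpa using hx
    · rintro ⟨φ, hφ, rfl⟩
      refine ⟨e.symm (WeakDual.toStrongDual φ), ?_, ?_⟩
      · rw [Seminorm.mem_closedBall_zero]
        simpa using hφ
      · ext y
        rw [hL]
        simp
  rw [himg]
  exact (WeakDual.isCompact_closedBall 0 1).image WeakDual.coeFn_continuous

theorem hasBanachPredual_of_compactSpace {X : Type u} [NormedAddCommGroup X] [NormedSpace 𝕜 X]
    {D : Type*} [TopologicalSpace D] [CompactSpace D] (d : D → X)
    (hd : Set.range d = Metric.closedBall 0 1)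
    (hsep : ∀ x : X, 1 < ‖x‖ → ∃ g ∈ dualContinuousOn (𝕜 := 𝕜) d, ‖g‖ ≤ 1 ∧ 1 < ‖g x‖) :
    HasBanachPredual 𝕜 (inferInstance : TopologicalSpace X) := by
  let Y := dualContinuousOn (𝕜 := 𝕜) d
  have hle : ∀ w, ‖d w‖ ≤ 1 := fun w => by
    have : d w ∈ Metric.closedBall (0 : X) 1 := hd ▸ ⟨w, rfl⟩
    simpa using this
  have hc : CompleteSpace Y := (isClosed_dualContinuousOn d hle).completeSpace_coe
  let nY : NormedAddCommGroup Y := inferInstance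
  let sY : NormedSpace 𝕜 Y := inferInstance
  refine ⟨Y, nY.toAddCommGroup, sY.toModule, inferInstance, isLCHausdorff_of_normedSpace Y,
    isCompletelyNormable_of_completeSpace Y, ?_⟩
  refine nonempty_equiv_strongDual_of_compact d hd (Y := Y) (Submodule.subtypeₗᵢ Y)
    (fun g => g.2) fun x hx => ?_
  obtain ⟨g, hg, hg1, hgx⟩ := hsep x hx
  exact ⟨⟨g, hg⟩, hg1, hgx⟩

theorem hasBanachPredual_of_isCompact_closedBall {p : Seminorm 𝕜 E} {τ τ' : TopologicalSpace E}
    (hp : IsNormInducing 𝕜 p τ) (h : IsLCHausdorff 𝕜 τ')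
    (hK : @IsCompact E τ' (p.closedBall 0 1)) : HasBanachPredual 𝕜 τ := by
  have hdef := hp.definite
  have ht : τ = (p.normedAddCommGroup hdef).toUniformSpace.toTopologicalSpace := hp.topology_eq
  clear hp
  subst ht
  obtain ⟨D, _, _, d, hdc, hd⟩ := hK.exists_compactSpace_range_eq
  have hcl : @IsClosed E τ' (p.closedBall 0 1) := @IsCompact.isClosed E τ' h.t2 _ hK
  have hsep := fun (x : E) (hx : 1 < p x) =>
    exists_continuous_of_isClosed_closedBall hdef h hcl one_pos hx
  let := p.normedAddCommGroup hdef
  let := p.normedSpace hdef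
  refine hasBanachPredual_of_compactSpace d ?_ fun x hx => ?_
  · rw [hd]
    ext x
    rw [Seminorm.mem_closedBall_zero, mem_closedBall_zero_iff]
    rfl
  · obtain ⟨g, hg, hgp, hgx⟩ := hsep x hx
    exact ⟨g.mkContinuous 1 fun y => (hgp y).trans_eq (one_mul _).symm, hg.comp hdc,
      g.mkContinuous_norm_le zero_le_one _, hgx⟩

theorem Seminorm.smul_closedBall_eq (p : Seminorm 𝕜 E) {r : ℝ} (hr : 0 < r) :
    p.closedBall 0 r = (r : 𝕜) • p.closedBall 0 1 := by
  rw [Seminorm.smul_closedBall_zero (by simp [hr.ne'])]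
  simp [abs_of_pos hr]

theorem IsLCHausdorff.isCompact_closedBall [τ' : TopologicalSpace E] (h : IsLCHausdorff 𝕜 τ')
    {p : Seminorm 𝕜 E} (hK : IsCompact (p.closedBall 0 1)) {r : ℝ} (hr : 0 < r) :
    IsCompact (p.closedBall 0 r) := by
  have := h.continuousSMul
  rw [p.smul_closedBall_eq hr]
  exact hK.smul _

theorem satisfiesBBC_of_isCompact_closedBall {p : Seminorm 𝕜 E} {τ τ' : TopologicalSpace E}
    (hp : IsNormInducing 𝕜 p τ) (h : IsLCHausdorff 𝕜 τ')
    (hK : @IsCompact E τ' (p.closedBall 0 1)) : SatisfiesBBC 𝕜 τ τ' := by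
  intro S hS
  obtain ⟨r, hr, hSr⟩ := hp.isBddFor_iff.1 hS
  exact ⟨_, hSr, p.absConvex_closedBall r, hp.isBddFor_iff.2 ⟨r, hr, subset_rfl⟩,
    h.isCompact_closedBall hK hr⟩

theorem SatisfiesBBC.satisfiesBBCl {τ τ' : TopologicalSpace E} (h : SatisfiesBBC 𝕜 τ τ')
    (h' : IsLCHausdorff 𝕜 τ') : SatisfiesBBCl 𝕜 τ τ' := by
  intro S hS
  obtain ⟨K, hSK, hK, hKb, hKc⟩ := h S hS
  exact ⟨K, hSK, hK, hKb, @IsCompact.isClosed E τ' h'.t2 _ hKc⟩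

theorem IsNormInducing.nhds_zero_hasBasis_closedBall {p : Seminorm 𝕜 E} {τ : TopologicalSpace E}
    (hp : IsNormInducing 𝕜 p τ) :
    (𝓝 (0 : E)).HasBasis (fun r : ℝ => 0 < r) fun r => p.closedBall 0 r := by
  refine ⟨fun V => ⟨fun hV => ?_, fun ⟨r, hr, hrV⟩ => ?_⟩⟩
  · obtain ⟨s, r, hr, hrV⟩ := (hp.induces.mem_nhds_iff 0 V).1 hV
    refine ⟨r / 2, half_pos hr, fun x hx => hrV ?_⟩
    rw [Seminorm.mem_closedBall_zero] at hx
    rw [Seminorm.mem_ball_zero]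
    exact Seminorm.finset_sup_apply_lt hr fun _ _ => by linarith
  · exact (hp.induces.mem_nhds_iff 0 _).2
      ⟨{0}, r, hr, by simpa using (p.ball_subset_closedBall 0 r).trans hrV⟩

theorem satisfiesCNC_of_isCompact_closedBall {p : Seminorm 𝕜 E} {τ τ' : TopologicalSpace E}
    (hp : IsNormInducing 𝕜 p τ) (h : IsLCHausdorff 𝕜 τ')
    (hK : @IsCompact E τ' (p.closedBall 0 1)) : SatisfiesCNC 𝕜 τ τ' := by
  intro V hV
  have hbasis := hp.nhds_zero_hasBasis_closedBall
  obtain ⟨r, hr, hrV⟩ := hbasis.mem_iff.1 hV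
  exact ⟨_, hbasis.mem_of_mem hr, hrV, p.absConvex_closedBall r,
    @IsCompact.isClosed E τ' h.t2 _ (h.isCompact_closedBall hK hr)⟩

theorem IsNormInducing.continuous_of_isVonNBounded {p : Seminorm 𝕜 E} {τ : TopologicalSpace E}
    (hp : IsNormInducing 𝕜 p τ) (hτ : IsTopologicalAddGroup E) {F : Type*} [AddCommGroup F]
    [Module 𝕜 F] [TopologicalSpace F] [IsTopologicalAddGroup F] (f : E →ₗ[𝕜] F)
    (hf : IsVonNBounded 𝕜 (f '' p.closedBall 0 1)) : Continuous f := by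
  refine continuous_of_continuousAt_zero f fun V hV => ?_
  rw [map_zero] at hV
  obtain ⟨a, ha, ha0⟩ := ((hf hV).and (eventually_ne_cobounded (0 : 𝕜))).exists
  refine mem_map.2 (mem_of_superset (hp.nhds_zero_hasBasis_closedBall.mem_of_mem
    (inv_pos.2 (norm_pos_iff.2 ha0))) fun x hx => ?_)
  rw [Seminorm.mem_closedBall_zero] at hx
  replace hx := mul_le_mul_of_nonneg_left hx (norm_nonneg a)
  rw [mul_inv_cancel₀ (norm_ne_zero_iff.2 ha0)] at hx
  obtain ⟨v, hv, hvx⟩ := ha ⟨a • x, by rwa [Seminorm.mem_closedBall_zero, map_smul_eq_mul], rfl⟩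
  rw [map_smul] at hvx
  rw [Set.mem_preimage, ← smul_right_injective F ha0 hvx]
  exact hv

theorem IsLCHausdorff.isVonNBounded_of_isCompact [τ' : TopologicalSpace E]
    (h : IsLCHausdorff 𝕜 τ') {K : Set E} (hK : IsCompact K) : IsVonNBounded 𝕜 K := by
  have := h.topologicalAddGroup
  have := h.continuousSMul
  exact hK.isVonNBounded 𝕜

/-- Compact sets are bounded, so the identity sends the unit ball to a `τ'`-bounded set and is
therefore continuous. -/
theorem IsNormInducing.le_of_isCompact_closedBall {p : Seminorm 𝕜 E} {τ τ' : TopologicalSpace E}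
    (hp : IsNormInducing 𝕜 p τ) (hτ : IsLCHausdorff 𝕜 τ) (h : IsLCHausdorff 𝕜 τ')
    (hK : @IsCompact E τ' (p.closedBall 0 1)) : τ ≤ τ' := by
  refine continuous_id_iff_le.1 ?_
  have := h.topologicalAddGroup
  have := h.continuousSMul
  refine hp.continuous_of_isVonNBounded hτ.topologicalAddGroup LinearMap.id ?_
  rw [LinearMap.id_coe, Set.image_id]
  exact h.isVonNBounded_of_isCompact hK

/-- Strong continuity bounds `f` by the supremum over some bounded `S`. Since `S` lies in a multiple
of `Set.range d`, a multiple of `f` is dominated by the supremum over this compact disk. -/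
theorem isSemiReflexive_of_compactSpace (γ : TopologicalSpace E) {D : Type*} [TopologicalSpace D]
    [CompactSpace D] [Nonempty D] (d : D → E) (hd : AbsConvex 𝕜 (Set.range d))
    (hc : ∀ g : E →ₗ[𝕜] 𝕜, Continuous g → Continuous fun w => g (d w))
    (hb : ∀ S, IsBddFor 𝕜 γ S → ∃ c : 𝕜, S ⊆ c • Set.range d) : IsSemiReflexive 𝕜 γ := by
  intro f
  have hf : f ⁻¹' Metric.ball 0 1 ∈ 𝓝 (0 : StrongDual 𝕜 E) :=
    f.continuous.continuousAt.preimage_mem_nhds (by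
      rw [map_zero]; exact Metric.ball_mem_nhds 0 one_pos)
  obtain ⟨⟨S, ε⟩, ⟨hS, hε⟩, hSf⟩ :=
    (ContinuousLinearMap.hasBasis_nhds_zero_of_basis Metric.nhds_basis_ball).mem_iff.1 hf
  obtain ⟨c, hc'⟩ := hb S hS
  let t : ℝ := ε / (2 * (‖c‖ + 1))
  have ht : 0 < t := by positivity
  have htn : ‖(t : 𝕜)‖ = t := by rw [RCLike.norm_ofReal, abs_of_pos ht]
  obtain ⟨w, hw⟩ := exists_eq_eval_of_bound_on_compact d hd
    (ContinuousLinearMap.coeLM 𝕜 : StrongDual 𝕜 E →ₗ[𝕜] E →ₗ[𝕜] 𝕜)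
    (fun g => hc g g.continuous)
    ((t : 𝕜) • (f : StrongDual 𝕜 E →ₗ[𝕜] 𝕜)) (by
      intro g hg
      have : (t : 𝕜) • g ∈ f ⁻¹' Metric.ball 0 1 := hSf fun x hx => by
        obtain ⟨_, ⟨w, rfl⟩, rfl⟩ := hc' hx
        rw [mem_ball_zero_iff, smul_apply, map_smul, norm_smul, norm_smul, htn]
        have h1 : ‖c‖ * ‖g (d w)‖ ≤ ‖c‖ * 1 := mul_le_mul_of_nonneg_left (hg w) (norm_nonneg c)
        have h2 : t * (‖c‖ * ‖g (d w)‖) ≤ t * (‖c‖ + 1) :=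
          mul_le_mul_of_nonneg_left (by linarith) ht.le
        have h3 : t * (‖c‖ + 1) = ε / 2 := by
          simp only [t]
          field_simp
        change _ < ε
        linarith [half_lt_self hε]
      rw [Set.mem_preimage, map_smul, mem_ball_zero_iff] at this
      exact this.le)
  refine ⟨(t : 𝕜)⁻¹ • d w, fun g => ?_⟩
  have := hw g
  rw [LinearMap.smul_apply] at this
  rw [map_smul, eq_inv_smul_iff₀ (by simpa using ht.ne')]
  exact this

/-- In a semi-reflexive space, a bounded set which equals its bipolar is weakly compact. -/
theorem IsSemiReflexive.isCompact_image_eval {γ : TopologicalSpace E} (h : IsSemiReflexive 𝕜 γ)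
    {K : Set E} (hK : IsBddFor 𝕜 γ K)
    (hsep : ∀ x ∉ K, ∃ g : StrongDual 𝕜 E, (∀ y ∈ K, ‖g y‖ ≤ 1) ∧ 1 < ‖g x‖) :
    IsCompact ((fun x (g : StrongDual 𝕜 E) => g x) '' K) := by
  have hbd : ∀ g : StrongDual 𝕜 E, ∃ r, ∀ x ∈ K, ‖g x‖ ≤ r := by
    intro g
    obtain ⟨a, ha⟩ := (hK ((g : E →ₗ[𝕜] 𝕜).preimage_ball_mem_nhds_zero g.continuous one_pos)).exists
    refine ⟨‖a‖, fun x hx => ?_⟩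
    obtain ⟨y, hy, rfl⟩ := ha hx
    have hy' : ‖g y‖ < 1 := by simpa using hy
    simp only [map_smul, norm_smul]
    exact mul_le_of_le_one_right (norm_nonneg _) hy'.le
  choose r hr using hbd
  -- The image consists of the linear forms on the dual that respect the bounds `r` and the bipolar
  -- condition. It is thus closed in a product of compact disks.
  have heq : (fun x (g : StrongDual 𝕜 E) => g x) '' K =
      (Set.pi Set.univ fun g => Metric.closedBall (0 : 𝕜) (r g)) ∩
        (Set.range ((↑) : (StrongDual 𝕜 E →ₗ[𝕜] 𝕜) → StrongDual 𝕜 E → 𝕜) ∩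
          ⋂ g ∈ {g : StrongDual 𝕜 E | ∀ y ∈ K, ‖g y‖ ≤ 1}, {F | ‖F g‖ ≤ 1}) := by
    ext F
    constructor
    · rintro ⟨x, hx, rfl⟩
      refine ⟨fun g _ => by simpa using hr g x hx, ⟨(LinearMap.applyₗ x).comp
        (ContinuousLinearMap.coeLM 𝕜), rfl⟩, Set.mem_iInter₂.2 fun g hg => hg x hx⟩
    · rintro ⟨-, ⟨f, rfl⟩, hF⟩
      have hle : ∀ g : StrongDual 𝕜 E, (∀ y ∈ K, ‖g y‖ ≤ 1) → ‖f g‖ ≤ 1 := fun g hg =>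
        Set.mem_iInter₂.1 hF g hg
      -- The polar of the bounded set `K` is a strong neighbourhood of zero on which `f` is bounded
      -- by one.
      have hcont : Continuous f := by
        refine continuous_of_continuousAt_zero f ?_
        rw [ContinuousAt, map_zero]
        refine Metric.tendsto_nhds.2 fun ε hε => ?_
        have hmem : {g : StrongDual 𝕜 E | ∀ y ∈ K, g y ∈ Metric.ball (0 : 𝕜) (ε / 2)} ∈
            𝓝 (0 : StrongDual 𝕜 E) :=
          (ContinuousLinearMap.hasBasis_nhds_zero_of_basis Metric.nhds_basis_ball).mem_of_mem
            (i := (K, ε / 2)) ⟨hK, half_pos hε⟩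
        have hn : ‖(((ε / 2)⁻¹ : ℝ) : 𝕜)‖ = (ε / 2)⁻¹ := by
          rw [RCLike.norm_ofReal, abs_of_pos (by positivity)]
        filter_upwards [hmem] with g hg
        have := hle ((((ε / 2)⁻¹ : ℝ) : 𝕜) • g) fun y hy => by
          have := (mem_ball_zero_iff.1 (hg y hy)).le
          rwa [smul_apply, norm_smul, hn, inv_mul_le_one₀ (by positivity)]
        rw [map_smul, norm_smul, hn, inv_mul_le_one₀ (by positivity)] at this
        rw [dist_zero_right]
        linarith
      obtain ⟨x, hx⟩ := h ⟨f, hcont⟩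
      refine ⟨x, ?_, funext fun g => (hx g).symm⟩
      by_contra hxK
      obtain ⟨g, hg, hgx⟩ := hsep x hxK
      refine hgx.not_ge ?_
      rw [← hx g]
      exact hle g hg
  rw [heq]
  refine (isCompact_univ_pi fun g => isCompact_closedBall 0 (r g)).inter_right
    ((LinearMap.isClosed_range_coe _ _ _).inter ?_)
  exact isClosed_biInter fun g _ => isClosed_le (continuous_apply g).norm continuous_const

end Implications

/-! ### Renorming by the gauge of a compact disk -/

section Gauge

variable {𝕜 : Type} [RCLike 𝕜] {E : Type u} [AddCommGroup E] [Module 𝕜 E]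

/-- A closed absolutely convex set between two balls of a norm is the unit ball of an equivalent
seminorm. -/
theorem AbsConvex.exists_seminorm_closedBall_eq [TopologicalSpace E] [ContinuousSMul 𝕜 E]
    {K : Set E} (hK : AbsConvex 𝕜 K) (hcl : IsClosed K) {p : Seminorm 𝕜 E}
    (hp : ∀ x, p x = 0 → x = 0) {r : ℝ} (hr : 0 < r) (h₁ : p.closedBall 0 1 ⊆ K)
    (h₂ : K ⊆ p.closedBall 0 r) :
    ∃ q : Seminorm 𝕜 E, q.closedBall 0 1 = K ∧ (∀ x, q x ≤ p x) ∧ ∀ x, p x ≤ r * q x := by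
  let : Module ℝ E := Module.restrictScalars ℝ 𝕜 E
  have : IsScalarTower ℝ 𝕜 E := IsScalarTower.restrictScalars ℝ 𝕜 E
  have : ContinuousSMul ℝ E := IsScalarTower.continuousSMul 𝕜
  have hconv : Convex ℝ K := convex_RCLike_iff_convex_real.1 hK.2
  have hsm : ∀ (t : ℝ) (x : E), p (t • x) = |t| * p x := fun t x => by
    rw [← algebraMap_smul 𝕜 t x, map_smul_eq_mul, RCLike.algebraMap_eq_ofReal, RCLike.norm_ofReal]
  have hmem : ∀ x, x ∈ p x • K := fun x => by
    rcases (apply_nonneg p x).eq_or_lt with h0 | h0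
    · rw [← h0, hp x h0.symm]
      exact ⟨0, h₁ (by simp), by simp⟩
    · refine (Set.mem_smul_set_iff_inv_smul_mem₀ h0.ne' _ _).2 (h₁ ?_)
      rw [Seminorm.mem_closedBall_zero, hsm, abs_of_pos (inv_pos.2 h0), inv_mul_cancel₀ h0.ne']
  have habs : Absorbent ℝ K := by
    intro x
    refine Absorbs.of_norm ⟨max (p x) 1, fun c hc => Set.singleton_subset_iff.2 ?_⟩
    have hc0 : 0 < |c| := one_pos.trans_le ((le_max_right _ _).trans hc)
    refine (Set.mem_smul_set_iff_inv_smul_mem₀ (abs_pos.1 hc0) _ _).2 (h₁ ?_)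
    rw [Seminorm.mem_closedBall_zero, hsm, abs_inv, inv_mul_le_one₀ hc0]
    exact (le_max_left _ _).trans hc
  have h0 : (0 : E) ∈ K := h₁ (by simp)
  refine ⟨gaugeSeminorm hK.1 hconv habs, ?_, fun x => ?_, fun x => ?_⟩
  · ext x
    rw [Seminorm.mem_closedBall_zero]
    exact ⟨fun hx => hcl.closure_eq ▸ mem_closure_of_gauge_le_one hconv h0 habs hx,
      gauge_le_one_of_mem⟩
  · exact gauge_le_of_mem (apply_nonneg p x) (hmem x)
  -- A factor `b` below the gauge plus `ε / r` puts the point in `b • K`, hence in the ball of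
  -- radius `b * r`; the slack becomes `ε` after multiplication by `r`.
  · refine le_of_forall_pos_le_add fun ε hε => ?_
    obtain ⟨b, hb, hbx, y, hy, rfl⟩ :=
      exists_lt_of_gauge_lt habs (lt_add_of_pos_right (gauge K x) (div_pos hε hr))
    have hyr := h₂ hy
    rw [Seminorm.mem_closedBall_zero] at hyr
    have h1 : p (b • y) ≤ b * r := by
      rw [hsm, abs_of_pos hb]
      exact mul_le_mul_of_nonneg_left hyr hb.le
    have h2 := mul_le_mul_of_nonneg_right hbx.le hr.le
    have h3 : ε / r * r = ε := div_mul_cancel₀ ε hr.ne'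
    change _ ≤ r * gauge K (b • y) + ε
    change b * r ≤ (gauge K (b • y) + ε / r) * r at h2
    linarith

theorem IsNormInducing.congr {τ : TopologicalSpace E} {p q : Seminorm 𝕜 E}
    (hp : IsNormInducing 𝕜 p τ) {r : ℝ} (hr : 0 < r) (hqp : ∀ x, q x ≤ p x)
    (hpq : ∀ x, p x ≤ r * q x) : IsNormInducing 𝕜 q τ where
  definite x hx := hp.definite x <| le_antisymm ((hpq x).trans_eq (by rw [hx, mul_zero]))
    (apply_nonneg p x)
  induces := hp.induces.congr
    (fun _ => ⟨{0}, 1, fun x => by simpa using hqp x⟩)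
    (fun _ => ⟨{0}, r.toNNReal, fun x => by
      simpa [NNReal.smul_def, hr.le] using hpq x⟩)

theorem SatisfiesBBC.exists_isCompact_closedBall {τ τ' : TopologicalSpace E}
    (h : SatisfiesBBC 𝕜 τ τ') (hτ : IsCompletelyNormable 𝕜 τ) (h' : IsLCHausdorff 𝕜 τ') :
    ∃ q : Seminorm 𝕜 E, IsNormInducing 𝕜 q τ ∧ @IsCompact E τ' (q.closedBall 0 1) := by
  obtain ⟨p, hp, -⟩ := hτ
  obtain ⟨K, hpK, hK, hKb, hKc⟩ := h _ (hp.isBddFor_iff.2 ⟨1, one_pos, subset_rfl⟩)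
  obtain ⟨r, hr, hKr⟩ := hp.isBddFor_iff.1 hKb
  obtain ⟨q, hq, hqp, hpq⟩ := @AbsConvex.exists_seminorm_closedBall_eq 𝕜 _ E _ _ τ'
    h'.continuousSMul K hK (@IsCompact.isClosed E τ' h'.t2 _ hKc) p hp.definite r hr hpK hKr
  exact ⟨q, hp.congr hr hqp hpq, hq ▸ hKc⟩

end Gauge

/-! ### The dual of a Banach space with compact convergence -/

section CompactConvergence

open scoped CompactConvergenceCLM

variable {𝕜 : Type} [RCLike 𝕜] {Z : Type u} [NormedAddCommGroup Z] [NormedSpace 𝕜 Z]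

theorem isLCHausdorff_compactConvergenceCLM :
    IsLCHausdorff 𝕜 (inferInstance : TopologicalSpace (Z →L_c[𝕜] 𝕜)) where
  t2 := inferInstance
  topologicalAddGroup := inferInstance
  continuousSMul := inferInstance
  locallyConvex := by
    have : LocallyConvexSpace 𝕜 𝕜 := RCLike.locallyConvexSpace_self
    exact UniformConvergenceCLM.locallyConvexSpace 𝕜 _ ⟨∅, isCompact_empty⟩
      (directedOn_of_sup_mem fun _ _ => IsCompact.union)

/-- These functionals share a Lipschitz constant, so pointwise and compact convergence agree on
them, and Alaoglu's theorem carries over. -/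
theorem isCompact_compactConvergenceCLM_setOf_norm_le {r : ℝ} (hr : 0 ≤ r) :
    IsCompact {φ : Z →L_c[𝕜] 𝕜 | ∀ x, ‖φ x‖ ≤ r * ‖x‖} := by
  let B : Set (WeakDual 𝕜 Z) := WeakDual.toStrongDual ⁻¹' Metric.closedBall (0 : StrongDual 𝕜 Z) r
  have hB : IsCompact B := WeakDual.isCompact_closedBall 0 r
  have : CompactSpace B := isCompact_iff_compactSpace.1 hB
  let j : B → (Z →L_c[𝕜] 𝕜) := fun φ => (WeakDual.toStrongDual φ.1 : StrongDual 𝕜 Z)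
  have hle : ∀ (φ : B) x, ‖j φ x‖ ≤ r * ‖x‖ := fun φ x =>
    (WeakDual.toStrongDual φ.1).le_of_opNorm_le (mem_closedBall_zero_iff.1 φ.2) x
  have hlip : ∀ φ : B, LipschitzWith r.toNNReal (j φ) := fun φ =>
    LipschitzWith.of_dist_le_mul fun x y => by
      rw [dist_eq_norm, dist_eq_norm, ← map_sub, Real.coe_toNNReal r hr]
      exact hle φ (x - y)
  have hj : Continuous j := by
    refine continuous_iff_continuousAt.2 fun φ => ?_
    refine ((UniformConvergenceCLM.isEmbedding_coeFn (RingHom.id 𝕜) 𝕜 _).tendsto_nhds_iff).2 ?_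
    refine (EquicontinuousOn.tendsto_uniformOnFun_iff_pi (𝔖 := {S : Set Z | IsCompact S})
      (F := fun (φ : B) x => j φ x) (fun K hK => hK) Set.sUnion_isCompact_eq_univ (fun K _ => ?_) _ _).2 ?_
    · exact (LipschitzWith.uniformEquicontinuous _ _ hlip).equicontinuous.equicontinuousOn K
    · exact (WeakDual.coeFn_continuous.comp continuous_subtype_val).continuousAt
  have himg : Set.range j = {φ : Z →L_c[𝕜] 𝕜 | ∀ x, ‖φ x‖ ≤ r * ‖x‖} := by
    ext φ
    constructor
    · rintro ⟨ψ, rfl⟩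
      exact hle ψ
    · intro hφ
      let f : StrongDual 𝕜 Z := φ
      exact ⟨⟨StrongDual.toWeakDual f, mem_closedBall_zero_iff.2 (f.opNorm_le_bound hr hφ)⟩, rfl⟩
  rw [← himg]
  exact isCompact_range hj

/-- Points are compact sets, so `S` is pointwise bounded and the Banach–Steinhaus theorem applies.
-/
theorem exists_norm_le_of_isBddFor_compactConvergenceCLM [CompleteSpace Z]
    {S : Set (Z →L_c[𝕜] 𝕜)} (hS : IsVonNBounded 𝕜 S) :
    ∃ r, 0 ≤ r ∧ S ⊆ {φ : Z →L_c[𝕜] 𝕜 | ∀ x, ‖φ x‖ ≤ r * ‖x‖} := by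
  obtain ⟨r, hr⟩ := banach_steinhaus (g := fun φ : S => (φ.1 : StrongDual 𝕜 Z)) fun x => by
    have h := UniformConvergenceCLM.isVonNBounded_image2_apply hS (isCompact_singleton (x := x))
    obtain ⟨C, hC⟩ := isBounded_iff_forall_norm_le.1 ((NormedSpace.isVonNBounded_iff 𝕜).1 h)
    exact ⟨C, fun φ => hC _ ⟨φ.1, φ.2, x, rfl, rfl⟩⟩
  exact ⟨max r 0, le_max_right _ _, fun φ hφ x => (φ : StrongDual 𝕜 Z).le_of_opNorm_le
    ((hr ⟨φ, hφ⟩).trans (le_max_left _ _)) x⟩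

theorem isSemiMontel_compactConvergenceCLM [CompleteSpace Z] :
    IsSemiMontel 𝕜 (inferInstance : TopologicalSpace (Z →L_c[𝕜] 𝕜)) := by
  intro S hS
  obtain ⟨r, hr, hSr⟩ := exists_norm_le_of_isBddFor_compactConvergenceCLM hS
  exact (isCompact_compactConvergenceCLM_setOf_norm_le hr).closure_of_subset hSr

theorem IsCompact.exists_isCompact_absConvex_superset [CompleteSpace Z] {C : Set Z}
    (hC : IsCompact C) : ∃ K : Set Z, C ⊆ K ∧ K.Nonempty ∧ AbsConvex 𝕜 K ∧ IsCompact K := by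
  let := NormedSpace.restrictScalars ℝ 𝕜 Z
  have : IsScalarTower ℝ 𝕜 Z := IsScalarTower.restrictScalars ℝ 𝕜 Z
  let A : Set Z := (fun x : 𝕜 × Z => x.1 • x.2) '' (Metric.closedBall 0 1 ×ˢ insert 0 C)
  have hA : IsCompact A := ((isCompact_closedBall 0 1).prod (hC.insert 0)).image
    (continuous_fst.smul continuous_snd)
  have hAb : Balanced 𝕜 A := by
    rintro a ha _ ⟨_, ⟨⟨b, x⟩, ⟨hb, hx⟩, rfl⟩, rfl⟩
    refine ⟨(a * b, x), ⟨?_, hx⟩, by simp [mul_smul]⟩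
    rw [mem_closedBall_zero_iff] at hb ⊢
    rw [norm_mul]
    exact mul_le_one₀ ha (norm_nonneg _) hb
  have hCA : insert 0 C ⊆ A := fun x hx => ⟨(1, x), ⟨by simp, hx⟩, one_smul _ _⟩
  have hAK : A ⊆ closure (convexHull 𝕜 A) := (subset_convexHull 𝕜 A).trans subset_closure
  -- The hull over `𝕜` inherits total boundedness from the real hull; completeness then makes its
  -- closure compact.
  have hconv : convexHull 𝕜 A ⊆ convexHull ℝ A := convexHull_min (subset_convexHull ℝ A)
    (convex_RCLike_iff_convex_real.2 (convex_convexHull ℝ A))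
  refine ⟨closure (convexHull 𝕜 A), ((Set.subset_insert 0 C).trans hCA).trans hAK,
    ⟨0, hAK (hCA (Set.mem_insert 0 C))⟩, ⟨hAb.convexHull.closure, ?_⟩, ?_⟩
  · exact convex_RCLike_iff_convex_real.2
      (convex_RCLike_iff_convex_real.1 (convex_convexHull 𝕜 A)).closure
  · exact (hA.totallyBounded.convexHull.subset hconv).closure.isCompact_of_isClosed isClosed_closure

/-- The evaluation of a continuous functional on the dual with the topology of compact
convergence. -/
def evalCompactConvergence (x : Z) : StrongDual 𝕜 (Z →L_c[𝕜] 𝕜) where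
  toFun φ := φ x
  map_add' _ _ := rfl
  map_smul' _ _ := rfl
  cont := ContinuousEvalConst.continuous_eval_const x

/-- As in the Mackey–Arens theorem, `F` is controlled by a compact set, which is enlarged to a
compact disk; `F` is then a multiple of evaluation at a point of this disk. -/
theorem exists_eq_evalCompactConvergence [CompleteSpace Z] (F : StrongDual 𝕜 (Z →L_c[𝕜] 𝕜)) :
    ∃ x, evalCompactConvergence x = F := by
  have hF : F ⁻¹' Metric.ball 0 1 ∈ 𝓝 (0 : Z →L_c[𝕜] 𝕜) :=
    F.continuous.continuousAt.preimage_mem_nhds (by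
      rw [map_zero]; exact Metric.ball_mem_nhds 0 one_pos)
  obtain ⟨⟨C, ε⟩, ⟨hC, hε⟩, hCF⟩ :=
    (CompactConvergenceCLM.hasBasis_nhds_zero_of_basis Metric.nhds_basis_ball).mem_iff.1 hF
  obtain ⟨K, hCK, hKne, hK, hKc⟩ := hC.exists_isCompact_absConvex_superset (𝕜 := 𝕜)
  have : CompactSpace K := isCompact_iff_compactSpace.1 hKc
  have : Nonempty K := hKne.to_subtype
  have htn : ‖((ε / 2 : ℝ) : 𝕜)‖ = ε / 2 := by
    rw [RCLike.norm_ofReal, abs_of_pos (half_pos hε)]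
  obtain ⟨w, hw⟩ := exists_eq_eval_of_bound_on_compact (Subtype.val : K → Z)
    (by rwa [Subtype.range_coe])
    (ContinuousLinearMap.coeLM 𝕜 : StrongDual 𝕜 Z →ₗ[𝕜] Z →ₗ[𝕜] 𝕜)
    (fun g => g.continuous.comp continuous_subtype_val)
    (((ε / 2 : ℝ) : 𝕜) • (F : (Z →L_c[𝕜] 𝕜) →ₗ[𝕜] 𝕜).comp
      (ContinuousLinearMap.toUniformConvergenceCLM (RingHom.id 𝕜) 𝕜 {S : Set Z | IsCompact S} :
        StrongDual 𝕜 Z →ₗ[𝕜] (Z →L_c[𝕜] 𝕜))) (by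
      intro g hg
      have : ((ε / 2 : ℝ) : 𝕜) • (ContinuousLinearMap.toUniformConvergenceCLM (RingHom.id 𝕜) 𝕜
          {S : Set Z | IsCompact S} g) ∈ F ⁻¹' Metric.ball 0 1 := hCF fun x hx => by
        change ((ε / 2 : ℝ) : 𝕜) • g x ∈ _
        rw [mem_ball_zero_iff, norm_smul, htn]
        have h1 := mul_le_mul_of_nonneg_left (hg ⟨x, hCK hx⟩) (half_pos hε).le
        change ε / 2 * ‖g x‖ ≤ _ at h1
        change _ < ε
        linarith
      rw [Set.mem_preimage, map_smul, mem_ball_zero_iff] at this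
      exact this.le)
  refine ⟨((ε / 2 : ℝ) : 𝕜)⁻¹ • w.1, ?_⟩
  ext φ
  have := hw (φ : StrongDual 𝕜 Z)
  change φ (_ • _) = _
  rw [map_smul, inv_smul_eq_iff₀ (by simpa using hε.ne')]
  exact this.symm

/-- A Banach space is the strong dual of its dual with the topology of compact convergence. -/
theorem nonempty_equiv_strongDual_compactConvergenceCLM [CompleteSpace Z] :
    Nonempty (Z ≃L[𝕜] StrongDual 𝕜 (Z →L_c[𝕜] 𝕜)) := by
  let Φ : Z →ₗ[𝕜] StrongDual 𝕜 (Z →L_c[𝕜] 𝕜) :=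
    { toFun := evalCompactConvergence
      map_add' := fun x y => by ext φ; exact map_add φ x y
      map_smul' := fun c x => by ext φ; exact map_smul φ c x }
  have hΦ : ∀ x φ, Φ x φ = φ x := fun x φ => rfl
  have hinj : Function.Injective Φ := by
    refine (injective_iff_map_eq_zero Φ).2 fun x hx => ?_
    refine SeparatingDual.eq_zero_of_forall_dual_eq_zero (R := 𝕜) fun g => ?_
    exact DFunLike.congr_fun hx (g : Z →L_c[𝕜] 𝕜)
  let e := LinearEquiv.ofBijective Φ ⟨hinj, exists_eq_evalCompactConvergence⟩
  have hbasis := ContinuousLinearMap.hasBasis_nhds_zero_of_basis (σ := RingHom.id 𝕜)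
    (E := Z →L_c[𝕜] 𝕜) (Metric.nhds_basis_closedBall (x := (0 : 𝕜)))
  refine ⟨⟨e, ?_, ?_⟩⟩
  · refine continuous_of_continuousAt_zero Φ ?_
    rw [ContinuousAt, map_zero, Metric.nhds_basis_closedBall.tendsto_iff hbasis]
    rintro ⟨S, ε⟩ ⟨hS, hε⟩
    obtain ⟨r, hr, hSr⟩ := exists_norm_le_of_isBddFor_compactConvergenceCLM hS
    refine ⟨ε / (r + 1), by positivity, fun x hx φ hφ => ?_⟩
    rw [mem_closedBall_zero_iff] at hx ⊢
    rw [le_div_iff₀ (by positivity)] at hx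
    rw [hΦ]
    have := hSr hφ x
    change _ ≤ ε
    nlinarith [norm_nonneg x]
  · refine continuous_of_continuousAt_zero e.symm ?_
    rw [ContinuousAt, map_zero, hbasis.tendsto_iff Metric.nhds_basis_closedBall]
    intro ε hε
    -- The dual unit ball is compact here, hence bounded. If evaluation at `x` is at most `ε` on it,
    -- a norming functional gives `‖x‖ ≤ ε`.
    refine ⟨(_, ε), ⟨(isCompact_compactConvergenceCLM_setOf_norm_le zero_le_one).isVonNBounded 𝕜, hε⟩,
      fun F hF => ?_⟩
    obtain ⟨x, rfl⟩ := e.surjective F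
    rw [e.symm_apply_apply, mem_closedBall_zero_iff]
    obtain ⟨g, hg, hgx⟩ := exists_dual_vector'' 𝕜 x
    have := mem_closedBall_zero_iff.1 (hF (g : Z →L_c[𝕜] 𝕜) fun y => g.le_of_opNorm_le hg y)
    change ‖g x‖ ≤ ε at this
    rwa [hgx, RCLike.norm_ofReal, abs_norm] at this

end CompactConvergence

/-! ### Prebiduals, mixed topologies and the final equivalences -/

section Equivalences

open scoped CompactConvergenceCLM

variable {𝕜 : Type} [RCLike 𝕜] {E : Type u} [AddCommGroup E] [Module 𝕜 E]

theorem HasBanachPredual.hasSemiMontelPrebidual {τ : TopologicalSpace E}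
    (h : HasBanachPredual 𝕜 τ) : HasSemiMontelPrebidualWithCompletelyNormableDual 𝕜 τ := by
  obtain ⟨Z, _, _, _, ⟨e⟩⟩ := h.exists_normed
  obtain ⟨Φ⟩ := nonempty_equiv_strongDual_compactConvergenceCLM (𝕜 := 𝕜) (Z := Z)
  exact ⟨Z →L_c[𝕜] 𝕜, inferInstance, inferInstance, inferInstance,
    isLCHausdorff_compactConvergenceCLM, isSemiMontel_compactConvergenceCLM,
    isCompletelyNormable_of_equiv _ Φ.symm,
    ⟨e.trans (Φ.arrowCongr (ContinuousLinearEquiv.refl 𝕜 𝕜))⟩⟩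

theorem HasSemiMontelPrebidualWithCompletelyNormableDual.hasBanachPredual {τ : TopologicalSpace E}
    (h : HasSemiMontelPrebidualWithCompletelyNormableDual 𝕜 τ) : HasBanachPredual 𝕜 τ := by
  obtain ⟨Y, _, _, σ, hσ, -, hc, he⟩ := h
  have := hσ.continuousSMul
  have : LocallyConvexSpace 𝕜 𝕜 := RCLike.locallyConvexSpace_self
  exact ⟨StrongDual 𝕜 Y, inferInstance, inferInstance, inferInstance,
    ⟨inferInstance, inferInstance, inferInstance, inferInstance⟩, hc, he⟩

theorem sameBoundedSets_of_isCompact_closedBall {p : Seminorm 𝕜 E} {τ τ' : TopologicalSpace E}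
    (hτ : IsLCHausdorff 𝕜 τ) (hp : IsNormInducing 𝕜 p τ) (h : IsLCHausdorff 𝕜 τ')
    (hK : @IsCompact E τ' (p.closedBall 0 1)) :
    SameBoundedSets 𝕜 τ (mixedTopology 𝕜 τ τ') := by
  obtain ⟨B, hB⟩ := hp.exists_isMixedBasis
    ((satisfiesBBC_of_isCompact_closedBall hp h hK).satisfiesBBCl h)
  exact fun S => ⟨isBddFor_mixedTopology (hp.le_of_isCompact_closedBall hτ h hK) hB,
    isBddFor_of_isBddFor_mixedTopology hp h (@IsCompact.isClosed E τ' h.t2 _ hK)⟩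

theorem isSemiReflexive_mixedTopology_of_isCompact_closedBall {p : Seminorm 𝕜 E}
    {τ τ' : TopologicalSpace E} (hp : IsNormInducing 𝕜 p τ) (h : IsLCHausdorff 𝕜 τ')
    (hK : @IsCompact E τ' (p.closedBall 0 1)) :
    IsSemiReflexive 𝕜 (mixedTopology 𝕜 τ τ') := by
  obtain ⟨B, hB⟩ := hp.exists_isMixedBasis
    ((satisfiesBBC_of_isCompact_closedBall hp h hK).satisfiesBBCl h)
  obtain ⟨D, _, _, d, hdc, hd⟩ := hK.exists_compactSpace_range_eq
  have : Nonempty D := Set.range_nonempty_iff_nonempty.1 (by rw [hd]; exact ⟨0, by simp⟩)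
  refine isSemiReflexive_of_compactSpace _ d (hd ▸ p.absConvex_closedBall 1) (fun g hg => ?_)
    fun S hS => ?_
  · exact continuous_comp_of_mixedTopology h hB hdc
      (hp.isBddFor_iff.2 ⟨1, one_pos, hd.subset⟩) g hg
  · obtain ⟨r, hr, hSr⟩ := hp.isBddFor_iff.1 (isBddFor_of_isBddFor_mixedTopology hp h
      (@IsCompact.isClosed E τ' h.t2 _ hK) hS)
    exact ⟨(r : 𝕜), by rwa [hd, ← p.smul_closedBall_eq hr]⟩

/-- Separation by functionals which are continuous for a topology finer than a locally convex
one. -/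
theorem AbsConvex.exists_strongDual_separating_of_le {γ τ' : TopologicalSpace E}
    (h : IsLCHausdorff 𝕜 τ') (hle : γ ≤ τ') {C : Set E} (hC : AbsConvex 𝕜 C)
    (hcl : @IsClosed E τ' C) (hne : C.Nonempty) {x : E} (hx : x ∉ C) :
    ∃ g : @StrongDual 𝕜 _ _ E γ _ _, (∀ y ∈ C, ‖g y‖ ≤ 1) ∧ 1 < ‖g x‖ := by
  obtain ⟨g, hg, hgx⟩ := @AbsConvex.exists_strongDual_separating 𝕜 _ E _ _ τ'
    h.topologicalAddGroup h.continuousSMul h.locallyConvex C hC hcl hne x hx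
  exact ⟨@ContinuousLinearMap.mk 𝕜 𝕜 _ _ (RingHom.id 𝕜) E γ _ 𝕜 _ _ _ _ g
    (continuous_le_dom hle (@ContinuousLinearMap.cont _ _ _ _ _ _ τ' _ _ _ _ _ _ g)), hg, hgx⟩

/-- The topology `σ` is the weak topology of the `γ`-dual. It is Hausdorff because `γ` is finer than
`τ'`, whose continuous functionals separate points; these also separate `τ'`-closed disks from
outside points. -/
theorem exists_satisfiesBBC_of_isSemiReflexive {τ τ' : TopologicalSpace E}
    (hτ : IsCompletelyNormable 𝕜 τ) (h : IsLCHausdorff 𝕜 τ') (hle : τ ≤ τ')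
    (hcl : SatisfiesBBCl 𝕜 τ τ') (hsr : IsSemiReflexive 𝕜 (mixedTopology 𝕜 τ τ')) :
    ∃ σ : TopologicalSpace E, IsLCHausdorff 𝕜 σ ∧ SatisfiesBBC 𝕜 τ σ := by
  obtain ⟨p, hp, -⟩ := hτ
  obtain ⟨B, hB⟩ := hp.exists_isMixedBasis hcl
  have hγ := mixedTopology_le (𝕜 := 𝕜) τ τ' h
  have hbdd : ∀ S, IsBddFor 𝕜 τ S → IsBddFor 𝕜 (mixedTopology 𝕜 τ τ') S := fun S hS =>
    isBddFor_mixedTopology hle hB hS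
  have hsep0 := fun (x : E) (hx : x ≠ 0) =>
    AbsConvex.exists_strongDual_separating_of_le (𝕜 := 𝕜) h hγ (C := {0})
      ⟨balanced_zero, convex_singleton 0⟩ (@isClosed_singleton E τ' (@T2Space.t1Space E τ' h.t2) 0)
      ⟨0, rfl⟩ (x := x) hx
  have hsep := fun (K : Set E) (hK : AbsConvex 𝕜 K) (hKc : @IsClosed E τ' K) (hne : K.Nonempty)
      (x : E) (hx : x ∉ K) =>
    AbsConvex.exists_strongDual_separating_of_le (𝕜 := 𝕜) h hγ hK hKc hne hx
  generalize hG : mixedTopology 𝕜 τ τ' = γ at *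
  let L : E →ₗ[𝕜] (@StrongDual 𝕜 _ _ E γ _ _) → 𝕜 := LinearMap.pi fun g => g.toLinearMap
  have hinj : Function.Injective L := by
    refine (injective_iff_map_eq_zero L).2 fun x hx => ?_
    by_contra hx0
    obtain ⟨g, -, hg⟩ := hsep0 x hx0
    have : g x = 0 := congrFun hx g
    rw [this, norm_zero] at hg
    linarith
  refine ⟨_, isLCHausdorff_induced_pi L hinj, fun S hS => ?_⟩
  -- Adding zero keeps `K` nonempty when `S` is empty, as separation requires.
  have hS0 : IsBddFor 𝕜 τ (insert 0 S) := by
    obtain ⟨r, hr, hSr⟩ := hp.isBddFor_iff.1 hS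
    exact hp.isBddFor_iff.2 ⟨r, hr, Set.insert_subset (by simpa using hr.le) hSr⟩
  obtain ⟨K, hSK, hK, hKb, hKc⟩ := hcl _ hS0
  refine ⟨K, (Set.subset_insert 0 S).trans hSK, hK, hKb, isCompact_induced_of_isCompact_image ?_⟩
  exact hsr.isCompact_image_eval (hbdd K hKb)
    (hsep K hK hKc ⟨0, hSK (Set.mem_insert 0 S)⟩)

end Equivalences

-- In Mathlib's order on topologies, `τ ≤ τ'` says that `τ'` is coarser than `τ`.
theorem mainTheorem5 {𝕜 : Type} [RCLike 𝕜] {X : Type*} [AddCommGroup X] [Module 𝕜 X]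
    (τ : TopologicalSpace X) (hτ : IsLCHausdorff 𝕜 τ) (hborn : IsBornological 𝕜 τ) :
    List.TFAE [
      HasBanachPredual 𝕜 τ,
      HasSemiMontelPrebidualWithCompletelyNormableDual 𝕜 τ,
      IsCompletelyNormable 𝕜 τ ∧
        ∃ τ' : TopologicalSpace X, IsLCHausdorff 𝕜 τ' ∧
          SatisfiesBBC 𝕜 τ τ' ∧ SatisfiesCNC 𝕜 τ τ' ∧
          SameBoundedSets 𝕜 τ (mixedTopology 𝕜 τ τ'),
      IsCompletelyNormable 𝕜 τ ∧
        ∃ τ' : TopologicalSpace X, IsLCHausdorff 𝕜 τ' ∧ τ ≤ τ' ∧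
          SatisfiesBBCl 𝕜 τ τ' ∧ IsSemiReflexive 𝕜 (mixedTopology 𝕜 τ τ'),
      IsCompletelyNormable 𝕜 τ ∧
        ∃ τ' : TopologicalSpace X, IsLCHausdorff 𝕜 τ' ∧ SatisfiesBBC 𝕜 τ τ',
      ∃ p : Seminorm 𝕜 X, IsNormInducing 𝕜 p τ ∧
        ∃ τ' : TopologicalSpace X, IsLCHausdorff 𝕜 τ' ∧
          @IsCompact X τ' (p.closedBall 0 1)] := by
  tfae_have 1 → 2 := HasBanachPredual.hasSemiMontelPrebidual
  tfae_have 2 → 1 := HasSemiMontelPrebidualWithCompletelyNormableDual.hasBanachPredual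
  tfae_have 1 → 6 := HasBanachPredual.exists_isCompact_closedBall
  tfae_have 6 → 1 := fun ⟨_, hp, _, h, hK⟩ => hasBanachPredual_of_isCompact_closedBall hp h hK
  tfae_have 6 → 3 := fun ⟨_, hp, τ', h, hK⟩ =>
    ⟨(hasBanachPredual_of_isCompact_closedBall hp h hK).isCompletelyNormable, τ', h,
      satisfiesBBC_of_isCompact_closedBall hp h hK, satisfiesCNC_of_isCompact_closedBall hp h hK,
      sameBoundedSets_of_isCompact_closedBall hτ hp h hK⟩
  tfae_have 6 → 4 := fun ⟨_, hp, τ', h, hK⟩ =>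
    ⟨(hasBanachPredual_of_isCompact_closedBall hp h hK).isCompletelyNormable, τ', h,
      hp.le_of_isCompact_closedBall hτ h hK,
      (satisfiesBBC_of_isCompact_closedBall hp h hK).satisfiesBBCl h,
      isSemiReflexive_mixedTopology_of_isCompact_closedBall hp h hK⟩
  tfae_have 3 → 5 := fun ⟨hc, τ', h, hB, _⟩ => ⟨hc, τ', h, hB⟩
  tfae_have 4 → 5 := fun ⟨hc, _, h, hle, hcl, hsr⟩ =>
    ⟨hc, exists_satisfiesBBC_of_isSemiReflexive hc h hle hcl hsr⟩
  tfae_have 5 → 6 := fun ⟨hc, τ', h, hB⟩ =>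
    have ⟨q, hq, hK⟩ := hB.exists_isCompact_closedBall hc h
    ⟨q, hq, τ', h, hK⟩
  tfae_finish
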